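/- Let $W$ be the principal branch of the Lambert function on $\mathbb C$: $W(z)$ is the solution $w$ of $we^w=z$ that lies in the set of all $w=x+iv$ ($x,v\in\mathbb R$) with $-\pi<v<\pi$ and either $x>-v\cot v$, or $x=-v\cot v$ and $v\ge 0$ (where $-v\cot v$ means $-1$ at $v=0$). Thus $W$ is holomorphic in $\mathbb C\setminus(-\infty,-1/e]$, positive on $(0,\infty)$, and takes on the cut $(-\infty,-1/e]$ its boundary values from the upper half-plane. The function $W(z)/z$ is given the value $\lim_{z\to0}W(z)/z=1$ at $z=0$. Then $W(z)/z$ is a Stieltjes function. That is: (a) There are a constant $a\ge 0$ and a positive measure $\mu$ on $[0,\infty)$ with $\int_0^\infty(1+t)^{-1}\,d\mu(t)<\infty$ such that $$\frac{W(x)}{x}=a+\int_0^\infty\frac{d\mu(t)}{x+t}\qquad(x>0).$$ (b) For $u\ge0$ the integral $$\Phi(u)=\frac1\pi\int_0^u \operatorname{Im}W(-1/t)\,dt$$ converges, the function $\Phi$ is bounded and nondecreasing on $[0,\infty)$ and constant on $[e,\infty)$, and $$\frac{W(z)}{z}=\int_0^\infty\frac{d\Phi(u)}{1+uz}\qquad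 (|\arg z|<\pi).$$ (c) More precisely, $$\frac{W(z)}{z}=\int_0^e\frac{d\Phi(u)}{1+uz}\qquad\text{for all } z\in\mathbb C\setminus(-\infty,-1/e].$$ -/

import Mathlib

noncomputable section

/-- The range of the principal branch of the Lambert function: the part of the strip
`|Im w| < π` to the right of the curve `{-v cot v + i v}` (which passes through `-1` at `v = 0`),
together with the half `v ≥ 0` of that curve, which is the image of the branch cut
`(-∞, -1/e]` (values on the cut are the limits from the upper half-plane). -/
def lambertRange : Set ℂ :=
  {w | (w.im = 0 ∧ -1 ≤ w.re) ∨
    (0 < w.im ∧ w.im < Real.pi ∧ -w.im * Real.cot w.im ≤ w.re) ∨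
    (-Real.pi < w.im ∧ w.im < 0 ∧ -w.im * Real.cot w.im < w.re)}

/-- The principal branch `W = W₀` of the Lambert function on the whole complex plane: `W z` is the
solution `w` of `w * exp w = z` in the range of the principal branch. -/
def lambertW (z : ℂ) : ℂ :=
  Function.invFunOn (fun w : ℂ => w * Complex.exp w) lambertRange z

/-- The function `W(z)/z`, with its removable singularity at `0` filled in by
`lim_{z → 0} W(z)/z = 1`. -/
def lambertQuot (z : ℂ) : ℂ :=
  if z = 0 then 1 else lambertW z / z

/-- The plane cut along the branch cut, `ℂ ∖ (-∞, -1/e]`. -/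
def lambertDomain : Set ℂ :=
  {z | ¬ (z.im = 0 ∧ z.re ≤ -1 / Real.exp 1)}

/-- `Φ(u) = (1/π) ∫₀ᵘ Im W(-1/t) dt`. -/
def lambertPhi (u : ℝ) : ℝ :=
  (1 / Real.pi) * ∫ t in (0 : ℝ)..u, (lambertW ((-1 / t : ℝ) : ℂ)).im

/-- `f : (0, ∞) → ℝ` is a Stieltjes function: `f x = a + ∫_{[0,∞)} dμ(t) / (x + t)` for `x > 0`,
with a constant `a ≥ 0` and a positive measure `μ` on `[0, ∞)` such that
`∫ (1 + t)⁻¹ dμ(t) < ∞`.  (Values of `f` outside `(0, ∞)` play no role.) -/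
def IsStieltjesFunction (f : ℝ → ℝ) : Prop :=
  ∃ a : ℝ, 0 ≤ a ∧ ∃ μ : MeasureTheory.Measure NNReal,
    MeasureTheory.Integrable (fun t : NNReal => (1 + (t : ℝ))⁻¹) μ ∧
    ∀ x : ℝ, 0 < x → f x = a + ∫ t : NNReal, 1 / (x + (t : ℝ)) ∂μ

theorem monotone_comp_max {Φ : ℝ → ℝ} (hΦ : MonotoneOn Φ (Set.Ici 0)) :
    Monotone (fun u : ℝ => Φ (max u 0)) :=
  fun _ _ h => hΦ (Set.mem_Ici.2 (le_max_right _ _)) (Set.mem_Ici.2 (le_max_right _ _))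
    (max_le_max_right 0 h)

/-- The Lebesgue–Stieltjes measure `dΦ` on `[0, ∞)` of a function `Φ` that is nondecreasing on
`[0, ∞)`; a jump of `Φ` at `0`, of size `Φ(0+) - Φ(0)`, counts as an atom at `0`. -/
def stieltjesMeasure (Φ : ℝ → ℝ) (hΦ : MonotoneOn Φ (Set.Ici 0)) : MeasureTheory.Measure ℝ :=
  (monotone_comp_max hΦ).stieltjesFunction.measure

/-- `f` is represented in the cut plane `ℂ ∖ (-∞, 0]` by the Stieltjes integral
`f z = ∫₀^∞ dΦ(u) / (1 + u z)`, where `Φ` is bounded and nondecreasing on `[0, ∞)`. -/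
structure IsStieltjesIntegral (f : ℂ → ℂ) (Φ : ℝ → ℝ) : Prop where
  mono : MonotoneOn Φ (Set.Ici 0)
  bounded : ∃ C : ℝ, ∀ u : ℝ, 0 ≤ u → |Φ u| ≤ C
  integrable : ∀ z ∈ Complex.slitPlane,
    MeasureTheory.IntegrableOn (fun u : ℝ => 1 / (1 + (u : ℂ) * z)) (Set.Ici 0)
      (stieltjesMeasure Φ mono)
  eq_integral : ∀ z ∈ Complex.slitPlane,
    f z = ∫ u in Set.Ici (0 : ℝ), 1 / (1 + (u : ℂ) * z) ∂(stieltjesMeasure Φ mono)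

end

/-!
For `z` in the cut plane put `L z = (1/π) ∫₀^π log (1 + z t(θ)) dθ`, where
`t(θ) = (sin θ / θ) exp (θ cot θ)`. The theorem follows from `L = W`.

*From `L` to `Φ`.* The boundary curve `w = -θ cot θ + i θ` of the range of `W` satisfies
`w exp w = -1 / t(θ)` (`mul_exp_boundary`), and `t` decreases strictly from `e` to `0` on `[0, π]`
(`strictAntiOn_cutRecip_Ico`). Hence `u ↦ Im W(-1/u)` is the inverse function of `t`, continued by
`0` (`cutIm_cutRecip`, `lt_cutIm_iff`). Writing `log (1 + z t)` as the integral of `z / (1 + u z)`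
over `0 < u < t` and exchanging the integrations gives
`L z = (z/π) ∫₀^e Im W(-1/u) / (1 + u z) du` (`integral_cutIm_mul`, `cutLogMean_eq`), and
`Im W(-1/u) / π` is the density of `dΦ` (`stieltjesMeasure_lambertPhi`). The Stieltjes function
on the half-line is the same integral in the variable `1 / u`.

*`L` inverts `w exp w` near `0`.* On the curve `w = θ cot θ + i θ` one has `exp w / w = t(θ)`, so
that the moments of `t` are contour integrals of `(exp w / w) ^ n`, and the contour can be moved to
the unit circle (`integral_cutRecip_pow`). In the logarithmic coordinate the integrand is entire and
`2πi`-periodic, so a primitive and its constant increment over a period replace the deformation of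
the contour. Summing a geometric series, `L'` is the average of `q / (1 + z q)` over the unit circle
with `q = exp w / w`, and for small `z = ζ exp ζ` Cauchy's formula at `-ζ`, the only zero of
`w + z exp w` in the unit disc, evaluates it (`circleAverage_inv_one_add`). It follows that
`L (ζ exp ζ)` has derivative `1` near `0`.

*`L = W` on the cut plane.* By the identity theorem `L exp L = z` everywhere
(`cutLogMean_mul_exp`). The values of `L` stay in the range of `W`: `|Im L| ≤ π`, because the
argument is at most `π`, and a connectedness argument applies as a boundary value would give a point
`z` of the cut (`cutLogMean_mem_lambertRange`). Finally `w exp w` is injective on the range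
(`injOn_mul_exp`), since `log w + w` is injective on the upper half-plane.
-/

noncomputable section LambertStieltjes

open Real Set Filter Topology MeasureTheory

/-! ### The reciprocal cut point as a function of the imaginary part -/

/-- The point `-1 / z` as a function of the imaginary part `θ` of `w = -θ cot θ + i θ`, where
`z = w * exp w` runs through the branch cut: `(sin θ / θ) * exp (θ cot θ)`. In terms of `sinc` the
removable singularity at `0` is filled in, and the value at `±π` is the limit `0`. -/
def cutRecip (θ : ℝ) : ℝ := sinc θ * exp (cos θ / sinc θ)

theorem mul_sinc (θ : ℝ) : θ * sinc θ = sin θ := by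
  rcases eq_or_ne θ 0 with rfl | h
  · simp
  · rw [sinc_of_ne_zero h]; field_simp

theorem sinc_pos_of_abs_lt_pi {θ : ℝ} (h : |θ| < π) : 0 < sinc θ := by
  rcases abs_lt.1 h with ⟨h1, h2⟩
  rcases lt_trichotomy θ 0 with h0 | rfl | h0
  · rw [sinc_of_ne_zero h0.ne]
    exact div_pos_of_neg_of_neg (sin_neg_of_neg_of_neg_pi_lt h0 h1) h0
  · simp
  · rw [sinc_of_ne_zero h0.ne']
    exact div_pos (sin_pos_of_pos_of_lt_pi h0 h2) h0

theorem abs_lt_pi_of_mem_Ico {θ : ℝ} (h : θ ∈ Ico 0 π) : |θ| < π := by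
  rw [abs_of_nonneg h.1]; exact h.2

theorem sinc_pi : sinc π = 0 := by rw [sinc_of_ne_zero pi_ne_zero]; simp

theorem cutRecip_zero : cutRecip 0 = exp 1 := by simp [cutRecip]

theorem cutRecip_pi : cutRecip π = 0 := by simp [cutRecip, sinc_pi]

theorem cutRecip_neg (θ : ℝ) : cutRecip (-θ) = cutRecip θ := by simp [cutRecip]

theorem cutRecip_pos {θ : ℝ} (h : |θ| < π) : 0 < cutRecip θ :=
  mul_pos (sinc_pos_of_abs_lt_pi h) (exp_pos _)

theorem measurable_cutRecip : Measurable cutRecip := by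
  have := continuous_sinc.measurable
  unfold cutRecip
  fun_prop

theorem hasDerivAt_cutRecip {θ : ℝ} (h0 : 0 < θ) (hp : θ < π) :
    HasDerivAt cutRecip
      (exp (θ * cos θ / sin θ) *
        (-((θ - sin θ * cos θ) ^ 2 + sin θ ^ 4) / (θ ^ 2 * sin θ))) θ := by
  have hs : sin θ ≠ 0 := (sin_pos_of_pos_of_lt_pi h0 hp).ne'
  have hev : cutRecip =ᶠ[𝓝 θ] fun x => sin x / x * exp (x * cos x / sin x) := by
    filter_upwards [eventually_ne_nhds h0.ne'] with x hx
    rw [cutRecip, sinc_of_ne_zero hx, div_div_eq_mul_div, mul_comm (cos x)]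
  refine HasDerivAt.congr_of_eventuallyEq ?_ hev
  refine HasDerivAt.congr_deriv (((hasDerivAt_sin θ).div (hasDerivAt_id θ) h0.ne').mul
    ((((hasDerivAt_id θ).mul (hasDerivAt_cos θ)).div (hasDerivAt_sin θ) hs).exp)) ?_
  simp only [id, Pi.div_apply, Pi.mul_apply]
  have h2 := sin_sq_add_cos_sq θ
  have h3 : -((θ - sin θ * cos θ) ^ 2 + sin θ ^ 4) / (θ ^ 2 * sin θ) =
      (cos θ * θ - sin θ * 1) / θ ^ 2 +
        sin θ / θ * (((1 * cos θ + θ * -sin θ) * sin θ - θ * cos θ * cos θ) / sin θ ^ 2) := by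
    field_simp
    linear_combination (θ ^ 2 - sin θ ^ 2) * h2
  rw [h3]
  ring

theorem continuousOn_cutRecip_Ico : ContinuousOn cutRecip (Ico 0 π) := by
  have hs : ∀ θ ∈ Ico 0 π, sinc θ ≠ 0 := fun θ h =>
    (sinc_pos_of_abs_lt_pi (abs_lt_pi_of_mem_Ico h)).ne'
  exact continuous_sinc.continuousOn.mul
    ((continuous_cos.continuousOn.div continuous_sinc.continuousOn hs).rexp)

theorem strictAntiOn_cutRecip_Ico : StrictAntiOn cutRecip (Ico 0 π) := by
  refine strictAntiOn_of_deriv_neg (convex_Ico _ _) continuousOn_cutRecip_Ico fun θ hθ => ?_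
  rw [interior_Ico] at hθ
  rw [(hasDerivAt_cutRecip hθ.1 hθ.2).deriv]
  have hs := sin_pos_of_pos_of_lt_pi hθ.1 hθ.2
  have h0 := hθ.1
  refine mul_neg_of_pos_of_neg (exp_pos _) (div_neg_of_neg_of_pos ?_ (by positivity))
  have : 0 < sin θ ^ 4 := by positivity
  nlinarith [sq_nonneg (θ - sin θ * cos θ)]

/-- The exponential factor stays bounded as `θ → π`, because there `cot θ < 0`. -/
theorem cutRecip_le_sinc {θ : ℝ} (h1 : π / 2 ≤ θ) (h2 : θ ≤ π) : cutRecip θ ≤ sinc θ := by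
  rcases h2.eq_or_lt with rfl | h2
  · rw [cutRecip_pi, sinc_pi]
  have hs := sinc_pos_of_abs_lt_pi (abs_lt_pi_of_mem_Ico ⟨by linarith [pi_pos], h2⟩)
  have hc : cos θ ≤ 0 := cos_nonpos_of_pi_div_two_le_of_le h1 (by linarith [pi_pos])
  refine mul_le_of_le_one_right hs.le (exp_le_one_iff.2 ?_)
  exact div_nonpos_of_nonpos_of_nonneg hc hs.le

theorem cutRecip_nonneg {θ : ℝ} (h : θ ∈ Icc 0 π) : 0 ≤ cutRecip θ := by
  rcases h.2.eq_or_lt with rfl | h2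
  · rw [cutRecip_pi]
  · exact (cutRecip_pos (abs_lt_pi_of_mem_Ico ⟨h.1, h2⟩)).le

theorem continuousOn_cutRecip : ContinuousOn cutRecip (Icc 0 π) := by
  intro θ hθ
  rcases hθ.2.eq_or_lt with rfl | h2
  · rw [ContinuousWithinAt, cutRecip_pi]
    refine tendsto_of_tendsto_of_tendsto_of_le_of_le' (g := fun _ => 0) (h := sinc)
      tendsto_const_nhds ?_ ?_ ?_
    · have := continuous_sinc.continuousWithinAt (s := Icc 0 π) (x := π)
      rwa [ContinuousWithinAt, sinc_pi] at this
    · exact eventually_mem_nhdsWithin.mono fun x hx => cutRecip_nonneg hx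
    · have : ∀ᶠ x in 𝓝[Icc 0 π] π, π / 2 < x :=
        (eventually_gt_nhds (by linarith [pi_pos])).filter_mono nhdsWithin_le_nhds
      filter_upwards [this, eventually_mem_nhdsWithin] with x h1 hx
      exact cutRecip_le_sinc h1.le hx.2
  · refine (continuousOn_cutRecip_Ico θ ⟨hθ.1, h2⟩).mono_of_mem_nhdsWithin ?_
    exact mem_nhdsWithin.2 ⟨Iio π, isOpen_Iio, h2, fun x hx => ⟨hx.2.1, hx.1⟩⟩

theorem cutRecip_le_exp_one {θ : ℝ} (h : |θ| < π) : cutRecip θ ≤ exp 1 := by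
  rw [← cutRecip_zero, show cutRecip θ = cutRecip |θ| by
    rcases abs_choice θ with h | h <;> rw [h]; rw [cutRecip_neg]]
  exact strictAntiOn_cutRecip_Ico.antitoneOn ⟨le_rfl, pi_pos⟩ ⟨abs_nonneg _, h⟩ (abs_nonneg _)

theorem cutRecip_mem_Icc {θ : ℝ} (h : θ ∈ Icc 0 π) : cutRecip θ ∈ Icc 0 (exp 1) := by
  refine ⟨cutRecip_nonneg h, ?_⟩
  rcases h.2.eq_or_lt with rfl | h2
  · rw [cutRecip_pi]; positivity
  · exact cutRecip_le_exp_one (abs_lt_pi_of_mem_Ico ⟨h.1, h2⟩)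

theorem exists_cutRecip_eq {u : ℝ} (h0 : 0 < u) (h1 : u ≤ exp 1) :
    ∃ θ ∈ Ico 0 π, cutRecip θ = u := by
  have := intermediate_value_Icc' pi_pos.le continuousOn_cutRecip
  rw [cutRecip_pi, cutRecip_zero] at this
  obtain ⟨θ, hθ, rfl⟩ := this ⟨h0.le, h1⟩
  refine ⟨θ, ⟨hθ.1, hθ.2.lt_of_ne ?_⟩, rfl⟩
  rintro rfl
  rw [cutRecip_pi] at h0
  exact h0.false

/-- The points `-θ cot θ + i θ` of the curve bounding the range are mapped to the cut. -/
theorem mul_exp_boundary {θ : ℝ} (h : |θ| < π) :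
    (⟨-(cos θ / sinc θ), θ⟩ : ℂ) * Complex.exp ⟨-(cos θ / sinc θ), θ⟩ =
      ((-1 / cutRecip θ : ℝ) : ℂ) := by
  have hs := (sinc_pos_of_abs_lt_pi h).ne'
  have h1 := mul_sinc θ
  have hθ : θ = sin θ / sinc θ := by field_simp; exact h1
  have hE : exp (-(cos θ / sinc θ)) = (exp (cos θ / sinc θ))⁻¹ := exp_neg _
  have hE0 := (exp_pos (cos θ / sinc θ)).ne'
  apply Complex.ext
  · rw [Complex.mul_re, Complex.exp_re, Complex.exp_im, Complex.ofReal_re]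
    simp only [cutRecip, hE]
    calc _ = -((cos θ / sinc θ) * cos θ + θ * sin θ) * (exp (cos θ / sinc θ))⁻¹ := by ring
      _ = -((cos θ / sinc θ) * cos θ + sin θ / sinc θ * sin θ) * (exp (cos θ / sinc θ))⁻¹ := by
          rw [← hθ]
      _ = -((cos θ ^ 2 + sin θ ^ 2) / sinc θ) * (exp (cos θ / sinc θ))⁻¹ := by ring
      _ = _ := by rw [cos_sq_add_sin_sq]; field_simp
  · rw [Complex.mul_im, Complex.exp_re, Complex.exp_im, Complex.ofReal_im]
    simp only
    calc _ = (θ - sin θ / sinc θ) * cos θ * exp (-(cos θ / sinc θ)) := by ring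
      _ = 0 := by rw [← hθ]; ring

/-! ### Injectivity of `w * exp w` and the boundary values of `W` -/

/-- For `0 < |Im w| < π`, this has the sign of `Re w - (-v cot v)`, where `v = Im w`; written with
`sinc` it is continuous everywhere. -/
def rangeSide (w : ℂ) : ℝ := w.re * sinc w.im + cos w.im

theorem continuous_rangeSide : Continuous rangeSide :=
  (Complex.continuous_re.mul (continuous_sinc.comp Complex.continuous_im)).add
    (continuous_cos.comp Complex.continuous_im)

theorem im_mul_exp (w : ℂ) :
    (w * Complex.exp w).im = exp w.re * w.im * rangeSide w := by
  rw [Complex.mul_im, Complex.exp_re, Complex.exp_im, rangeSide]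
  linear_combination (exp w.re * w.re) * (-mul_sinc w.im)

theorem neg_mul_cot_eq {v : ℝ} (h : |v| < π) (h0 : v ≠ 0) :
    -v * cot v = -(cos v / sinc v) := by
  have hs := (sinc_pos_of_abs_lt_pi h).ne'
  have h1 : sin v ≠ 0 := by rw [← mul_sinc]; exact mul_ne_zero h0 hs
  rw [cot_eq_cos_div_sin, ← mul_sinc v]
  field_simp

theorem mem_lambertRange_iff {w : ℂ} :
    w ∈ lambertRange ↔ |w.im| < π ∧ 0 ≤ rangeSide w ∧ (w.im < 0 → 0 < rangeSide w) := by
  by_cases hp : |w.im| < π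
  swap
  · refine ⟨fun h => absurd ?_ hp, fun h => absurd h.1 hp⟩
    rcases h with h | h | h
    · rw [h.1, abs_zero]; exact pi_pos
    · exact abs_lt.2 ⟨by linarith [pi_pos, h.1], h.2.1⟩
    · exact abs_lt.2 ⟨h.1, by linarith [pi_pos, h.2.1]⟩
  have hs := sinc_pos_of_abs_lt_pi hp
  have hp' := abs_lt.1 hp
  rcases lt_trichotomy w.im 0 with h | h | h
  · have : w ∈ lambertRange ↔ -(cos w.im / sinc w.im) < w.re := by
      rw [← neg_mul_cot_eq hp h.ne]
      simp [lambertRange, h, h.ne, h.not_gt, hp'.1]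
    rw [this, neg_lt_iff_pos_add, ← mul_pos_iff_of_pos_left hs, rangeSide, mul_add,
      mul_div_cancel₀ _ hs.ne', mul_comm, add_comm]
    exact ⟨fun h' => ⟨hp, h'.le, fun _ => h'⟩, fun h' => h'.2.2 h⟩
  · have : w ∈ lambertRange ↔ -1 ≤ w.re := by simp [lambertRange, h]
    rw [this, rangeSide, h]
    simp [pi_pos, neg_le_iff_add_nonneg]
  · have : w ∈ lambertRange ↔ -(cos w.im / sinc w.im) ≤ w.re := by
      rw [← neg_mul_cot_eq hp h.ne']
      simp [lambertRange, h, h.ne', h.not_gt, hp'.2]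
    rw [this, neg_le_iff_add_nonneg, ← mul_nonneg_iff_of_pos_left hs, rangeSide, mul_add,
      mul_div_cancel₀ _ hs.ne', mul_comm]
    exact ⟨fun h' => ⟨hp, h', fun h'' => absurd h'' h.not_gt⟩, fun h' => h'.2.1⟩

/-- On the boundary curve of the range, `w * exp w` lies on the cut. -/
theorem mul_exp_of_rangeSide_eq_zero {w : ℂ} (hp : |w.im| < π) (h : rangeSide w = 0) :
    w * Complex.exp w = ((-1 / cutRecip w.im : ℝ) : ℂ) := by
  have hs := (sinc_pos_of_abs_lt_pi hp).ne'
  have : w = ⟨-(cos w.im / sinc w.im), w.im⟩ := by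
    refine Complex.ext ?_ rfl
    rw [rangeSide] at h
    field_simp
    linarith
  rw [this]
  exact mul_exp_boundary hp

/-- The derivative `1 + 1 / w` has negative imaginary part in the upper half-plane, so on a segment
from `w₁` to `w₂` the quotient `(log w + w) / (w₂ - w₁)` has strictly decreasing imaginary part. -/
theorem injOn_log_add_self : InjOn (fun w : ℂ => Complex.log w + w) {w | 0 < w.im} := by
  intro a ha b hb hab
  simp only [mem_ofPred_eq] at ha hb hab
  by_contra hne
  set d := b - a with hd
  have hd0 : d ≠ 0 := sub_ne_zero.2 (Ne.symm hne)
  have him : ∀ s ∈ Icc (0 : ℝ) 1, 0 < (a + s * d).im := by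
    intro s hs
    have : (a + s * d).im = (1 - s) * a.im + s * b.im := by
      simp [hd]; ring
    rw [this]
    rcases hs.1.eq_or_lt with rfl | h
    · simpa using ha
    · nlinarith [mul_nonneg (sub_nonneg.2 hs.2) ha.le, mul_pos h hb]
  have hder : ∀ s ∈ Icc (0 : ℝ) 1,
      HasDerivAt (fun s : ℝ => ((Complex.log (a + s * d) + (a + s * d)) / d).im)
        ((a + s * d)⁻¹ + 1).im s := by
    intro s hs
    have hsl : a + s * d ∈ Complex.slitPlane := Or.inr (him s hs).ne'
    have h1 : HasDerivAt (fun s : ℝ => a + s * d) d s := by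
      simpa using ((Complex.ofRealCLM.hasDerivAt (x := s)).mul_const d).const_add a
    have h2 := ((h1.clog_real hsl).add h1).div_const d
    refine (Complex.imCLM.hasFDerivAt.comp_hasDerivAt s h2).congr_deriv ?_
    rw [Complex.imCLM_apply]
    congr 1
    field_simp
  have hanti : StrictAntiOn (fun s : ℝ => ((Complex.log (a + s * d) + (a + s * d)) / d).im)
      (Icc 0 1) := by
    refine strictAntiOn_of_deriv_neg (convex_Icc _ _)
      (fun s hs => (hder s hs).continuousAt.continuousWithinAt) fun s hs => ?_
    rw [interior_Icc] at hs
    have hs' := Ioo_subset_Icc_self hs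
    rw [(hder s hs').deriv, Complex.add_im, Complex.inv_im, Complex.one_im, add_zero]
    have : a + s * d ≠ 0 := fun h => by simpa [h] using him s hs'
    exact div_neg_of_neg_of_pos (neg_neg_of_pos (him s hs')) (Complex.normSq_pos.2 this)
  have := hanti (left_mem_Icc.2 zero_le_one) (right_mem_Icc.2 zero_le_one) zero_lt_one
  simp [hd, hab] at this

/-- If `0 ≤ Im (w * exp w)` and `0 < Im w < π`, then `Im (log w + w)` lies in `(0, π]`, so
`log w + w` is determined by its exponential `w * exp w`. -/
theorem eq_of_mul_exp_eq_of_im_pos {a b : ℂ} (ha : 0 < a.im) (ha' : a.im < π) (hb : 0 < b.im)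
    (hb' : b.im < π) (h : a * Complex.exp a = b * Complex.exp b)
    (him : 0 ≤ (a * Complex.exp a).im) : a = b := by
  have key : ∀ w : ℂ, 0 < w.im → w.im < π → 0 ≤ (w * Complex.exp w).im →
      Complex.exp (Complex.log w + w) = w * Complex.exp w ∧
        -π < (Complex.log w + w).im ∧ (Complex.log w + w).im ≤ π := by
    intro w h0 h1 h2
    have hw : w ≠ 0 := fun h => by simp [h] at h0
    have he : Complex.exp (Complex.log w + w) = w * Complex.exp w := by
      rw [Complex.exp_add, Complex.exp_log hw]
    have harg0 : 0 ≤ w.arg := Complex.arg_nonneg_iff.2 h0.le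
    have harg1 : w.arg ≤ π := Complex.arg_le_pi w
    have hi : (Complex.log w + w).im = w.arg + w.im := by simp [Complex.log_im]
    refine ⟨he, by rw [hi]; linarith [pi_pos], ?_⟩
    by_contra! hc
    rw [← he, Complex.exp_im] at h2
    have : sin ((Complex.log w + w).im) < 0 := by
      rw [← sin_sub_two_pi]
      exact sin_neg_of_neg_of_neg_pi_lt (by rw [hi]; linarith) (by linarith)
    exact absurd h2 (not_le.2 (mul_neg_of_pos_of_neg (exp_pos _) this))
  obtain ⟨ea, a1, a2⟩ := key a ha ha' him
  obtain ⟨eb, b1, b2⟩ := key b hb hb' (h ▸ him)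
  exact injOn_log_add_self ha hb
    (Complex.exp_inj_of_neg_pi_lt_of_le_pi a1 a2 b1 b2 (by rw [ea, eb, h]))

theorem strictMonoOn_mul_exp : StrictMonoOn (fun x : ℝ => x * exp x) (Ici (-1)) := by
  refine strictMonoOn_of_deriv_pos (convex_Ici _) (by fun_prop) fun x hx => ?_
  rw [interior_Ici, mem_Ioi] at hx
  have : HasDerivAt (fun x : ℝ => x * exp x) (1 * exp x + x * exp x) x :=
    (hasDerivAt_id x).mul (hasDerivAt_exp x)
  rw [this.deriv, ← add_mul]
  exact mul_pos (by linarith) (exp_pos _)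

theorem mul_exp_ofReal (x : ℝ) :
    ((x : ℂ) * Complex.exp (x : ℂ)) = ((x * exp x : ℝ) : ℂ) := by push_cast; rfl

theorem neg_inv_exp_one_le_mul_exp {x : ℝ} (hx : -1 ≤ x) : -1 / exp 1 ≤ x * exp x := by
  have := strictMonoOn_mul_exp.monotoneOn (self_mem_Ici) (mem_Ici.2 hx) hx
  simpa [exp_neg, neg_div] using this

/-- The sign of `Im (w * exp w)` separates the lower half of the range from the rest, and on the
upper boundary curve the real value `w * exp w` is less than `-1 / e`, the minimum on `[-1, ∞)`. -/
theorem injOn_mul_exp : InjOn (fun w : ℂ => w * Complex.exp w) lambertRange := by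
  -- a real point of the range and one above the real axis never have the same image
  have key : ∀ a b : ℂ, a ∈ lambertRange → b ∈ lambertRange → a.im = 0 → 0 < b.im →
      a * Complex.exp a ≠ b * Complex.exp b := by
    intro a b ha hb ha0 hb0 h
    rw [mem_lambertRange_iff] at ha hb
    have hz : (b * Complex.exp b).im = 0 := by rw [← h, im_mul_exp, ha0]; simp
    rw [im_mul_exp] at hz
    have hb1 : rangeSide b = 0 := by
      rcases mul_eq_zero.1 hz with hz | hz
      · exact absurd hz (mul_pos (exp_pos _) hb0).ne'
      · exact hz
    have ha1 : -1 ≤ a.re := by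
      have := ha.2.1
      rw [rangeSide, ha0] at this
      simp at this; linarith
    have har : a = (a.re : ℂ) := Complex.ext rfl (by simpa using ha0)
    rw [mul_exp_of_rangeSide_eq_zero hb.1 hb1, har, mul_exp_ofReal, Complex.ofReal_inj] at h
    have h1 := neg_inv_exp_one_le_mul_exp ha1
    have h2 : cutRecip b.im < exp 1 := by
      rw [← cutRecip_zero]
      exact strictAntiOn_cutRecip_Ico ⟨le_rfl, pi_pos⟩ ⟨hb0.le, (abs_lt.1 hb.1).2⟩ hb0
    have h3 := cutRecip_pos hb.1
    have h4 := one_div_lt_one_div_of_lt h3 h2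
    rw [h, neg_div, neg_div] at h1
    linarith
  have hsign : ∀ w ∈ lambertRange, w.im < 0 → (w * Complex.exp w).im < 0 := fun w hw h => by
    rw [im_mul_exp]
    exact mul_neg_of_neg_of_pos (mul_neg_of_pos_of_neg (exp_pos _) h)
      ((mem_lambertRange_iff.1 hw).2.2 h)
  have hsign' : ∀ w ∈ lambertRange, 0 ≤ w.im → 0 ≤ (w * Complex.exp w).im := fun w hw h => by
    rw [im_mul_exp]
    exact mul_nonneg (mul_nonneg (exp_pos _).le h) (mem_lambertRange_iff.1 hw).2.1
  intro a ha b hb h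
  simp only at h
  have hpa := abs_lt.1 (mem_lambertRange_iff.1 ha).1
  have hpb := abs_lt.1 (mem_lambertRange_iff.1 hb).1
  by_cases ha0 : a.im < 0
  · have h1 := hsign a ha ha0
    have hb0 : b.im < 0 := by
      by_contra! hb0
      exact absurd (hsign' b hb hb0) (by rw [← h]; exact not_le.2 h1)
    have hconj : ∀ w : ℂ, starRingEnd ℂ w * Complex.exp (starRingEnd ℂ w) =
        starRingEnd ℂ (w * Complex.exp w) := fun w => by
      rw [map_mul, Complex.exp_conj]
    refine (starRingEnd ℂ).injective (eq_of_mul_exp_eq_of_im_pos ?_ ?_ ?_ ?_ ?_ ?_)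
    · simpa using ha0
    · simp; linarith
    · simpa using hb0
    · simp; linarith
    · rw [hconj, hconj, h]
    · rw [hconj, Complex.conj_im]; linarith
  · have hb0 : ¬ b.im < 0 := fun hb0 =>
      absurd (hsign b hb hb0) (by rw [← h]; exact not_lt.2 (hsign' a ha (not_lt.1 ha0)))
    rcases (not_lt.1 ha0).eq_or_lt with ha1 | ha1 <;> rcases (not_lt.1 hb0).eq_or_lt with hb1 | hb1
    · have har : a = (a.re : ℂ) := Complex.ext rfl (by simpa using ha1.symm)
      have hbr : b = (b.re : ℂ) := Complex.ext rfl (by simpa using hb1.symm)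
      have hre : ∀ w ∈ lambertRange, 0 = w.im → -1 ≤ w.re := fun w hw h0 => by
        have := (mem_lambertRange_iff.1 hw).2.1
        rw [rangeSide, ← h0] at this
        simp at this; linarith
      rw [har, hbr, mul_exp_ofReal, mul_exp_ofReal, Complex.ofReal_inj] at h
      rw [har, hbr, strictMonoOn_mul_exp.injOn (hre a ha ha1) (hre b hb hb1) h]
    · exact absurd h (key a b ha hb ha1.symm hb1)
    · exact absurd h.symm (key b a hb ha hb1.symm ha1)
    · exact eq_of_mul_exp_eq_of_im_pos ha1 hpa.2 hb1 hpb.2 h (hsign' a ha ha1.le)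

theorem lambertW_mul_exp {w : ℂ} (hw : w ∈ lambertRange) : lambertW (w * Complex.exp w) = w :=
  injOn_mul_exp.leftInvOn_invFunOn hw

theorem exists_mul_exp_eq {y : ℝ} (hy : -1 / exp 1 ≤ y) : ∃ x : ℝ, -1 ≤ x ∧ x * exp x = y := by
  have h1 : (-1 : ℝ) ≤ |y| := by linarith [abs_nonneg y]
  have hc : ContinuousOn (fun x : ℝ => x * exp x) (Icc (-1) |y|) := by fun_prop
  obtain ⟨x, hx, rfl⟩ := intermediate_value_Icc h1 hc (show y ∈ Icc _ _ from by
    constructor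
    · simpa [exp_neg, neg_div] using hy
    · exact (le_abs_self y).trans (le_mul_of_one_le_right (abs_nonneg y)
        (one_le_exp (abs_nonneg y))))
  exact ⟨x, hx.1, rfl⟩

theorem im_lambertW_ofReal {y : ℝ} (hy : -1 / exp 1 ≤ y) : (lambertW (y : ℂ)).im = 0 := by
  obtain ⟨x, hx, rfl⟩ := exists_mul_exp_eq hy
  rw [← mul_exp_ofReal, lambertW_mul_exp (Or.inl ⟨by simp, by simpa using hx⟩)]
  simp

/-- `Im W(-1/u)`, the imaginary part of the boundary value of `W` at the cut point `-1/u`. -/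
def cutIm (u : ℝ) : ℝ := (lambertW ((-1 / u : ℝ) : ℂ)).im

theorem cutIm_cutRecip {θ : ℝ} (h : θ ∈ Ico 0 π) : cutIm (cutRecip θ) = θ := by
  have hp := abs_lt_pi_of_mem_Ico h
  have hs := (sinc_pos_of_abs_lt_pi hp).ne'
  rw [cutIm, ← mul_exp_boundary hp, lambertW_mul_exp]
  refine mem_lambertRange_iff.2 ⟨hp, le_of_eq ?_, fun h' => absurd h.1 (not_le.2 h')⟩
  simp only [rangeSide]
  field_simp
  ring

theorem cutIm_of_nonpos {u : ℝ} (h : u ≤ 0) : cutIm u = 0 := by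
  refine im_lambertW_ofReal ?_
  have : 0 ≤ -1 / u := div_nonneg_of_nonpos (by norm_num) h
  refine le_trans ?_ this
  exact div_nonpos_of_nonpos_of_nonneg (by norm_num) (exp_pos _).le

theorem cutIm_of_exp_one_le {u : ℝ} (h : exp 1 ≤ u) : cutIm u = 0 := by
  refine im_lambertW_ofReal ?_
  rw [neg_div, neg_div, neg_le_neg_iff]
  exact one_div_le_one_div_of_le (exp_pos _) h

theorem cutIm_mem_Ico (u : ℝ) : cutIm u ∈ Ico 0 π := by
  rcases le_or_gt u 0 with h | h
  · rw [cutIm_of_nonpos h]; exact ⟨le_rfl, pi_pos⟩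
  · rcases le_or_gt u (exp 1) with h' | h'
    · obtain ⟨θ, hθ, rfl⟩ := exists_cutRecip_eq h h'
      rwa [cutIm_cutRecip hθ]
    · rw [cutIm_of_exp_one_le h'.le]; exact ⟨le_rfl, pi_pos⟩

/-- `cutIm` is the generalized inverse of the decreasing function `cutRecip`. -/
theorem lt_cutIm_iff {u θ : ℝ} (hu : 0 < u) (hθ : θ ∈ Ico 0 π) :
    θ < cutIm u ↔ u < cutRecip θ := by
  rcases le_or_gt u (exp 1) with h' | h'
  · obtain ⟨φ, hφ, rfl⟩ := exists_cutRecip_eq hu h'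
    rw [cutIm_cutRecip hφ, strictAntiOn_cutRecip_Ico.lt_iff_gt hφ hθ]
  · rw [cutIm_of_exp_one_le h'.le]
    have := cutRecip_le_exp_one (abs_lt_pi_of_mem_Ico hθ)
    exact ⟨fun h => absurd hθ.1 (not_le.2 h), fun h => by linarith⟩

theorem antitoneOn_cutIm : AntitoneOn cutIm (Ioi 0) := by
  intro a ha b hb hab
  by_contra! h
  have h1 := (lt_cutIm_iff hb (cutIm_mem_Ico a)).1 h
  exact lt_irrefl _ ((lt_cutIm_iff ha (cutIm_mem_Ico a)).2 (hab.trans_lt h1))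

theorem measurable_cutIm : Measurable cutIm := by
  refine measurable_of_restrict_of_restrict_compl (measurableSet_Ioi (a := (0 : ℝ))) ?_ ?_
  · exact Antitone.measurable fun a b h => antitoneOn_cutIm a.2 b.2 h
  · have : (Ioi (0 : ℝ))ᶜ.domRestrict cutIm = fun _ => 0 := by
      funext x
      exact cutIm_of_nonpos (not_lt.1 x.2)
    rw [this]
    exact measurable_const

/-! ### Moments of `cutRecip` by change of contour -/

/-- The pullback of `(exp w / w) ^ n` under `w = exp s`; unlike that function it is entire. -/
def expPow (n : ℕ) (s : ℂ) : ℂ := Complex.exp (n * (Complex.exp s - s))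

theorem expPow_add_two_pi (n : ℕ) (s : ℂ) : expPow n (s + 2 * π * Complex.I) = expPow n s := by
  rw [expPow, expPow, Complex.exp_add s, Complex.exp_two_pi_mul_I,
    show (n : ℂ) * (Complex.exp s * 1 - (s + 2 * π * Complex.I)) =
      n * (Complex.exp s - s) - n * (2 * π * Complex.I) by ring, Complex.exp_sub,
    Complex.exp_nat_mul_two_pi_mul_I, div_one]

theorem expPow_eq (n : ℕ) (s : ℂ) :
    expPow n s = (Complex.exp (Complex.exp s) / Complex.exp s) ^ n := by
  rw [expPow, Complex.exp_nat_mul, Complex.exp_sub]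

/-- In the part of the strip `π/2 ≤ Im s ≤ 3π/2` where `0 ≤ Re s`, the function is bounded. -/
theorem norm_expPow_le_one (n : ℕ) {s : ℂ} (h0 : 0 ≤ s.re) (h1 : π / 2 ≤ s.im)
    (h2 : s.im ≤ π + π / 2) : ‖expPow n s‖ ≤ 1 := by
  rw [expPow, Complex.norm_exp, exp_le_one_iff]
  have : ((n : ℂ) * (Complex.exp s - s)).re = n * (exp s.re * cos s.im - s.re) := by
    rw [← Complex.ofReal_natCast, Complex.re_ofReal_mul, Complex.sub_re, Complex.exp_re]
  rw [this]
  refine mul_nonpos_of_nonneg_of_nonpos (Nat.cast_nonneg n) ?_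
  have := mul_nonpos_of_nonneg_of_nonpos (exp_pos s.re).le
    (cos_nonpos_of_pi_div_two_le_of_le h1 h2)
  linarith

/-- The logarithm `-log (sinc θ) + i θ` of the curve `θ cot θ + i θ`, which is the boundary curve
of the range, turned by `w ↦ -conj w`. -/
def logCurve (θ : ℝ) : ℂ := (-log (sinc θ) : ℝ) + θ * Complex.I

theorem expPow_logCurve (n : ℕ) {θ : ℝ} (h : |θ| < π) :
    expPow n (logCurve θ) = (cutRecip θ : ℂ) ^ n := by
  have hs := sinc_pos_of_abs_lt_pi h
  have h1 : Complex.exp (logCurve θ) = (cos θ / sinc θ : ℝ) + θ * Complex.I := by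
    rw [logCurve, Complex.exp_add, ← Complex.ofReal_exp, exp_neg, exp_log hs, Complex.exp_mul_I,
      ← Complex.ofReal_cos, ← Complex.ofReal_sin, ← mul_sinc θ]
    have := Complex.ofReal_ne_zero.2 hs.ne'
    push_cast
    field_simp
  have h2 : Complex.exp (logCurve θ) - logCurve θ =
      ((cos θ / sinc θ + log (sinc θ) : ℝ) : ℂ) := by
    rw [h1, logCurve]; push_cast; ring
  rw [expPow, h2, Complex.exp_nat_mul, ← Complex.ofReal_exp, exp_add, exp_log hs, mul_comm,
    cutRecip]

theorem hasDerivAt_logCurve {θ : ℝ} (h0 : θ ≠ 0) (h : |θ| < π) :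
    HasDerivAt logCurve ((1 / θ - cos θ / sin θ : ℝ) + Complex.I) θ := by
  have hs : sin θ ≠ 0 := by
    rw [← mul_sinc]; exact mul_ne_zero h0 (sinc_pos_of_abs_lt_pi h).ne'
  have hr : HasDerivAt (fun x => -log (sinc x)) (1 / θ - cos θ / sin θ) θ := by
    have hev : (fun x => -log (sinc x)) =ᶠ[𝓝 θ] fun x => -log (sin x / x) := by
      filter_upwards [eventually_ne_nhds h0] with x hx
      rw [sinc_of_ne_zero hx]
    refine HasDerivAt.congr_of_eventuallyEq ?_ hev
    refine HasDerivAt.congr_deriv ((((hasDerivAt_sin θ).div (hasDerivAt_id θ) h0).log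
      (div_ne_zero hs h0)).neg) ?_
    simp only [id, Pi.div_apply]
    field_simp
    ring
  have h1 : HasDerivAt (fun x : ℝ => (x : ℂ) * Complex.I) Complex.I θ := by
    simpa using (Complex.ofRealCLM.hasDerivAt (x := θ)).mul_const Complex.I
  exact hr.ofReal_comp.add h1

theorem continuousAt_logCurve_zero : ContinuousAt logCurve 0 := by
  have : ContinuousAt (fun θ => -log (sinc θ)) 0 :=
    (continuous_sinc.continuousAt.log (by simp)).neg
  exact (Complex.continuous_ofReal.continuousAt.comp this).add
    (Complex.continuous_ofReal.continuousAt.mul continuousAt_const)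

theorem logCurve_neg (θ : ℝ) : logCurve (-θ) = logCurve θ - 2 * θ * Complex.I := by
  simp only [logCurve, sinc_neg]; push_cast; ring

theorem intervalIntegrable_cutRecip_pow (n : ℕ) :
    IntervalIntegrable (fun θ => (cutRecip θ : ℂ) ^ n) volume 0 π := by
  refine ContinuousOn.intervalIntegrable ?_
  rw [uIcc_of_le pi_pos.le]
  exact (Complex.continuous_ofReal.comp_continuousOn continuousOn_cutRecip).pow n

/-- The moments of `cutRecip` are the circle averages of the powers of `exp w / w`. With a
primitive `P` of the entire function `expPow n`, the integral is the limit for `θ → π` of `1 / (2i)` times the increment of `P` along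
`logCurve` from `-θ` to `θ`. The end point and the translate of the initial point by `2πi` are joined
by a segment of length `2 (π - θ)` on which `Re (exp s) ≤ 0`, so that `expPow n` is bounded there. -/
theorem integral_cutRecip_pow (n : ℕ) :
    ∫ θ in (0 : ℝ)..π, (cutRecip θ : ℂ) ^ n =
      π * circleAverage (fun w => (Complex.exp w / w) ^ n) 0 1 := by
  have hd : Differentiable ℂ (expPow n) := by unfold expPow; fun_prop
  obtain ⟨P, hP⟩ := hd.isExactOn_univ
  replace hP : ∀ s, HasDerivAt P (expPow n s) s := fun s => hP s (mem_univ s)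
  set C : ℂ := P (0 + 2 * π * Complex.I) - P 0 with hC
  have hper : ∀ s, P (s + 2 * π * Complex.I) - P s = C := by
    have hder : ∀ s, HasDerivAt (fun s => P (s + 2 * π * Complex.I) - P s) 0 s := fun s => by
      have := ((hP (s + 2 * π * Complex.I)).comp_add_const s (2 * π * Complex.I)).sub (hP s)
      rwa [expPow_add_two_pi, sub_self] at this
    exact fun s => is_const_of_deriv_eq_zero (fun s => (hder s).differentiableAt)
      (fun s => (hder s).deriv) s 0
  -- the increment of `P` over a period, computed on the imaginary axis
  have hcirc : C = 2 * π * Complex.I * circleAverage (fun w => (Complex.exp w / w) ^ n) 0 1 := by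
    have hderiv : ∀ θ : ℝ, HasDerivAt (fun θ : ℝ => P (θ * Complex.I))
        (Complex.I * (fun w => (Complex.exp w / w) ^ n) (circleMap 0 1 θ)) θ := fun θ => by
      have h1 : HasDerivAt (fun x : ℝ => (x : ℂ) * Complex.I) Complex.I θ := by
        simpa using (Complex.ofRealCLM.hasDerivAt (x := θ)).mul_const Complex.I
      have := (hP (θ * Complex.I)).comp θ h1
      rw [expPow_eq, mul_comm] at this
      refine this.congr_deriv ?_
      simp [circleMap]
    have hcont : Continuous fun θ : ℝ =>
        Complex.I * (fun w => (Complex.exp w / w) ^ n) (circleMap 0 1 θ) := by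
      have h0 : ∀ θ, circleMap 0 1 θ ≠ 0 := fun θ => circleMap_ne_center one_ne_zero
      have h1 : Continuous (circleMap 0 1) := continuous_circleMap 0 1
      exact continuous_const.mul (((Complex.continuous_exp.comp h1).div h1 h0).pow n)
    have hint := intervalIntegral.integral_eq_sub_of_hasDerivAt (a := 0) (b := 2 * π)
      (fun θ _ => hderiv θ) (hcont.intervalIntegrable _ _)
    rw [intervalIntegral.integral_const_mul] at hint
    rw [circleAverage_def, Complex.real_smul]
    have hpi := Complex.ofReal_ne_zero.2 pi_ne_zero
    push_cast at hint ⊢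
    rw [hC, zero_add, show P 0 = P (0 * Complex.I) by rw [zero_mul], ← hint]
    field_simp
  have key : ∫ θ in (0 : ℝ)..π, 2 * Complex.I * (cutRecip θ : ℂ) ^ n = C - 0 := by
    refine intervalIntegral.integral_eq_sub_of_hasDerivAt_of_tendsto pi_pos
      (f := fun θ => P (logCurve θ) - P (logCurve (-θ))) ?_
      ((intervalIntegrable_cutRecip_pow n).const_mul _) ?_ ?_
    · intro θ hθ
      have hp : |θ| < π := abs_lt_pi_of_mem_Ico ⟨hθ.1.le, hθ.2⟩
      have hp' : |-θ| < π := by rwa [abs_neg]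
      have h1 := (hP (logCurve θ)).comp θ (hasDerivAt_logCurve hθ.1.ne' hp)
      have h2 := (hP (logCurve (-θ))).comp (-θ) (hasDerivAt_logCurve (neg_ne_zero.2 hθ.1.ne') hp')
      have h3 := h2.scomp θ (hasDerivAt_neg θ)
      refine (h1.sub h3).congr_deriv ?_
      rw [expPow_logCurve n hp, expPow_logCurve n hp', cutRecip_neg]
      simp only [sin_neg, cos_neg, neg_smul, one_smul]
      push_cast
      ring
    · have hc : ContinuousAt (fun θ => P (logCurve θ) - P (logCurve (-θ))) 0 := by
        have hPc : Continuous P := continuous_iff_continuousAt.2 fun s => (hP s).continuousAt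
        have hneg : ContinuousAt (fun θ => logCurve (-θ)) 0 :=
          ContinuousAt.comp (g := logCurve) (f := fun x => -x)
            (by simpa using continuousAt_logCurve_zero) continuous_neg.continuousAt
        exact (hPc.continuousAt.comp continuousAt_logCurve_zero).sub (hPc.continuousAt.comp hneg)
      have := hc.tendsto.mono_left (nhdsWithin_le_nhds (s := Ioi 0))
      simpa using this
    · have hbound : ∀ᶠ θ in 𝓝[<] π,
          ‖P (logCurve θ) - P (logCurve (-θ)) - C‖ ≤ 2 * (π - θ) := by
        have h2 : ∀ᶠ θ in 𝓝[<] π, π / 2 < θ :=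
          (eventually_gt_nhds (by linarith [pi_pos])).filter_mono nhdsWithin_le_nhds
        filter_upwards [h2, self_mem_nhdsWithin] with θ h2 h1
        have h1 : θ < π := h1
        have hp : |θ| < π := abs_lt_pi_of_mem_Ico ⟨by linarith [pi_pos], h1⟩
        have hre : 0 ≤ (logCurve θ).re := by
          simpa [logCurve] using log_nonpos (sinc_pos_of_abs_lt_pi hp).le (sinc_le_one θ)
        have him : (logCurve θ).im = θ := by simp [logCurve]
        set S : Set ℂ := {s | 0 ≤ s.re} ∩ ({s | π / 2 ≤ s.im} ∩ {s | s.im ≤ π + π / 2}) with hS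
        have hconv : Convex ℝ S := (convex_halfSpace_re_ge 0).inter
          ((convex_halfSpace_im_ge _).inter (convex_halfSpace_im_le _))
        have ha : logCurve θ ∈ S := by
          refine ⟨hre, ?_, ?_⟩ <;> simp only [mem_ofPred_eq, him] <;> linarith [pi_pos]
        have hb : logCurve (-θ) + 2 * π * Complex.I ∈ S := by
          have e1 : (logCurve (-θ) + 2 * π * Complex.I).re = (logCurve θ).re := by
            simp [logCurve_neg]
          have e2 : (logCurve (-θ) + 2 * π * Complex.I).im = 2 * π - θ := by
            simp [logCurve_neg, him]; ring
          refine ⟨?_, ?_, ?_⟩ <;> simp only [mem_ofPred_eq, e1, e2] <;> linarith [pi_pos]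
        have := hconv.norm_image_sub_le_of_norm_hasDerivWithin_le (C := 1)
          (fun s _ => (hP s).hasDerivWithinAt) (fun s hs => norm_expPow_le_one n hs.1 hs.2.1 hs.2.2)
          hb ha
        rw [show P (logCurve θ) - P (logCurve (-θ)) - C =
          P (logCurve θ) - P (logCurve (-θ) + 2 * π * Complex.I) by
            rw [← hper (logCurve (-θ))]; ring]
        refine this.trans_eq ?_
        rw [logCurve_neg, show logCurve θ - (logCurve θ - 2 * θ * Complex.I + 2 * π * Complex.I) =
          ((-(2 * (π - θ)) : ℝ) : ℂ) * Complex.I by push_cast; ring, norm_mul, Complex.norm_I,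
          Complex.norm_real, norm_neg, norm_of_nonneg (by linarith)]
        ring
      rw [tendsto_iff_norm_sub_tendsto_zero]
      refine squeeze_zero' (Eventually.of_forall fun _ => norm_nonneg _) hbound ?_
      have : Tendsto (fun θ => 2 * (π - θ)) (𝓝 π) (𝓝 (2 * (π - π))) :=
        (Continuous.tendsto (by fun_prop) π)
      rw [sub_self, mul_zero] at this
      exact this.mono_left nhdsWithin_le_nhds
  rw [intervalIntegral.integral_const_mul, sub_zero, hcirc] at key
  refine mul_left_cancel₀ (mul_ne_zero two_ne_zero Complex.I_ne_zero) ?_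
  rw [key]
  ring

/-! ### The logarithmic mean is the Lambert function -/

theorem isOpen_lambertDomain : IsOpen lambertDomain := by
  have : IsClosed {z : ℂ | z.im = 0 ∧ z.re ≤ -1 / exp 1} :=
    (isClosed_eq Complex.continuous_im continuous_const).inter
      (isClosed_le Complex.continuous_re continuous_const)
  exact this.isOpen_compl

theorem isPreconnected_lambertDomain : IsPreconnected lambertDomain := by
  have hneg : -1 / exp 1 < 0 := div_neg_of_neg_of_pos (by norm_num) (exp_pos _)
  have h0 : (0 : ℂ) ∈ lambertDomain := fun h => absurd h.2 (not_le.2 hneg)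
  have hstar : StarConvex ℝ (0 : ℂ) lambertDomain := by
    refine starConvex_zero_iff.2 fun z hz a ha ha1 h => ?_
    rw [Complex.smul_im, Complex.smul_re, smul_eq_mul, smul_eq_mul] at h
    rcases mul_eq_zero.1 h.1 with rfl | h1
    · exact absurd h.2 (by rw [zero_mul]; exact not_le.2 hneg)
    · have h2 : -1 / exp 1 < z.re := not_le.1 fun h' => hz ⟨h1, h'⟩
      rcases le_or_gt 0 z.re with h3 | h3
      · linarith [h.2, mul_nonneg ha h3]
      · nlinarith [h.2]
  exact (hstar.isPathConnected h0).isConnected.isPreconnected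

theorem mem_lambertDomain_of_norm {z : ℂ} (h : ‖z‖ * exp 1 < 1) : z ∈ lambertDomain := by
  intro hz
  have h1 := (abs_le.1 (Complex.abs_re_le_norm z)).1
  have h2 : ‖z‖ < 1 / exp 1 := (lt_div_iff₀ (exp_pos 1)).2 h
  have := hz.2
  rw [neg_div] at this
  linarith

theorem one_add_mul_mem_slitPlane {z : ℂ} (hz : z ∈ lambertDomain) {u : ℝ}
    (hu : u ∈ Icc 0 (exp 1)) : 1 + (u : ℂ) * z ∈ Complex.slitPlane := by
  by_contra h
  rw [Complex.mem_slitPlane_iff_not_le_zero, not_not, Complex.le_def] at h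
  simp only [Complex.add_re, Complex.one_re, Complex.re_ofReal_mul, Complex.zero_re,
    Complex.add_im, Complex.one_im, Complex.im_ofReal_mul, Complex.zero_im, zero_add] at h
  rcases mul_eq_zero.1 h.2 with rfl | h1
  · norm_num at h
  · refine hz ⟨h1, ?_⟩
    rw [le_div_iff₀ (exp_pos _)]
    by_contra! hlt
    rcases le_or_gt 0 z.re with h0 | h0
    · nlinarith [mul_nonneg hu.1 h0]
    · nlinarith [hu.2]

/-- The average of `log (1 + z t)` with respect to `dθ / π`, where `t = cutRecip θ`. It turns out
to be `W z`. -/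
def cutLogMean (z : ℂ) : ℂ :=
  (1 / π : ℝ) * ∫ θ in (0 : ℝ)..π, Complex.log (1 + (cutRecip θ : ℂ) * z)

theorem cutLogMean_zero : cutLogMean 0 = 0 := by simp [cutLogMean]

theorem continuousOn_log_one_add_cutRecip {z : ℂ} (hz : z ∈ lambertDomain) :
    ContinuousOn (fun θ => Complex.log (1 + (cutRecip θ : ℂ) * z)) (Icc 0 π) := by
  refine ContinuousOn.clog ?_ fun θ hθ => one_add_mul_mem_slitPlane hz (cutRecip_mem_Icc hθ)
  exact continuousOn_const.add
    ((Complex.continuous_ofReal.comp_continuousOn continuousOn_cutRecip).mul continuousOn_const)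

theorem hasDerivAt_cutLogMean {z : ℂ} (hz : z ∈ lambertDomain) :
    HasDerivAt cutLogMean ((1 / π : ℝ) *
      ∫ θ in (0 : ℝ)..π, (cutRecip θ : ℂ) / (1 + (cutRecip θ : ℂ) * z)) z := by
  obtain ⟨ε, hε, hball⟩ := Metric.nhds_basis_closedBall.mem_iff.1 (isOpen_lambertDomain.mem_nhds hz)
  have hcont : ContinuousOn (fun p : ℂ × ℝ => (p.2 : ℂ) / (1 + (p.2 : ℂ) * p.1))
      (Metric.closedBall z ε ×ˢ Icc 0 (exp 1)) := by
    refine ContinuousOn.div (by fun_prop) (by fun_prop) fun p hp => ?_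
    exact Complex.slitPlane_ne_zero (one_add_mul_mem_slitPlane (hball hp.1) hp.2)
  obtain ⟨C, hC⟩ :=
    ((isCompact_closedBall z ε).prod isCompact_Icc).exists_bound_of_continuousOn hcont
  have hI : ∀ θ ∈ uIoc 0 π, θ ∈ Icc 0 π := fun θ hθ => by
    rw [uIoc_of_le pi_pos.le] at hθ
    exact Ioc_subset_Icc_self hθ
  have hmeas := Complex.measurable_ofReal.comp measurable_cutRecip
  refine HasDerivAt.const_mul _ (intervalIntegral.hasDerivAt_integral_of_dominated_loc_of_deriv_le
    (F := fun x θ => Complex.log (1 + (cutRecip θ : ℂ) * x))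
    (F' := fun x θ => (cutRecip θ : ℂ) / (1 + (cutRecip θ : ℂ) * x))
    (s := Metric.closedBall z ε) (bound := fun _ => C) (Metric.closedBall_mem_nhds z hε)
    (Eventually.of_forall fun x => ?_) ?_ ?_ ?_ intervalIntegrable_const ?_).2
  · exact (Complex.measurable_log.comp ((hmeas.mul_const x).const_add 1)).aestronglyMeasurable
  · refine ContinuousOn.intervalIntegrable ?_
    rw [uIcc_of_le pi_pos.le]
    exact continuousOn_log_one_add_cutRecip hz
  · exact (hmeas.div ((hmeas.mul_const z).const_add 1)).aestronglyMeasurable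
  · exact Eventually.of_forall fun θ hθ x hx => hC (x, cutRecip θ) ⟨hx, cutRecip_mem_Icc (hI θ hθ)⟩
  · refine Eventually.of_forall fun θ hθ x hx => ?_
    have h1 : HasDerivAt (fun x : ℂ => 1 + (cutRecip θ : ℂ) * x) (cutRecip θ : ℂ) x := by
      simpa using ((hasDerivAt_id x).const_mul (cutRecip θ : ℂ)).const_add 1
    exact h1.clog (one_add_mul_mem_slitPlane (hball hx) (cutRecip_mem_Icc (hI θ hθ)))

/-- Integration of the geometric series of `f / (1 + f z)`. -/
theorem hasSum_intervalIntegral_geometric {f : ℝ → ℂ} {a b K : ℝ} {z : ℂ} (hK : 0 ≤ K)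
    (hz : ‖z‖ * K < 1) (hab : a ≤ b) (hf : ContinuousOn f (Icc a b))
    (hfK : ∀ x ∈ Icc a b, ‖f x‖ ≤ K) :
    HasSum (fun n : ℕ => (-z) ^ n * ∫ x in a..b, f x ^ (n + 1))
      (∫ x in a..b, f x / (1 + f x * z)) := by
  have hI : ∀ x ∈ uIoc a b, x ∈ Icc a b := fun x hx => by
    rw [uIoc_of_le hab] at hx
    exact Ioc_subset_Icc_self hx
  have hsum : Summable fun n : ℕ => K * (‖z‖ * K) ^ n :=
    (summable_geometric_of_lt_one (by positivity) hz).mul_left K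
  have := intervalIntegral.hasSum_integral_of_dominated_convergence (μ := volume) (a := a) (b := b)
    (F := fun n x => (-z) ^ n * f x ^ (n + 1)) (f := fun x => f x / (1 + f x * z))
    (fun n _ => K * (‖z‖ * K) ^ n) (fun n => ?_) (fun n => ?_) ?_ intervalIntegrable_const ?_
  · simpa only [intervalIntegral.integral_const_mul] using this
  · refine (ContinuousOn.mono ?_ hI).aestronglyMeasurable measurableSet_uIoc
    exact continuousOn_const.mul (hf.pow _)
  · refine Eventually.of_forall fun x hx => ?_
    have h1 := hfK x (hI x hx)
    calc ‖(-z) ^ n * f x ^ (n + 1)‖ = ‖z‖ ^ n * ‖f x‖ ^ (n + 1) := by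
          rw [norm_mul, norm_pow, norm_neg, norm_pow]
      _ ≤ ‖z‖ ^ n * K ^ (n + 1) := by gcongr
      _ = K * (‖z‖ * K) ^ n := by ring
  · exact Eventually.of_forall fun _ _ => hsum
  · refine Eventually.of_forall fun x hx => ?_
    have h1 : ‖-(f x * z)‖ < 1 := by
      rw [norm_neg, norm_mul, mul_comm]
      exact (mul_le_mul_of_nonneg_left (hfK x (hI x hx)) (norm_nonneg z)).trans_lt hz
    have h2 := (hasSum_geometric_of_norm_lt_one h1).mul_left (f x)
    rw [sub_neg_eq_add, ← div_eq_mul_inv] at h2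
    refine h2.congr_fun fun n => ?_
    rw [← mul_neg, mul_pow]; ring

theorem norm_exp_div_le {w : ℂ} (hw : ‖w‖ = 1) : ‖Complex.exp w / w‖ ≤ exp 1 := by
  rw [norm_div, hw, div_one, Complex.norm_exp]
  exact exp_le_exp.2 (hw ▸ Complex.re_le_norm w)

theorem norm_circleMap_zero_one (θ : ℝ) : ‖circleMap 0 1 θ‖ = 1 := by simp

/-- Equality of all moments turns the derivative of `cutLogMean` into an average over the unit
circle. -/
theorem integral_cutRecip_div {z : ℂ} (hz : ‖z‖ * exp 1 < 1) :
    ∫ θ in (0 : ℝ)..π, (cutRecip θ : ℂ) / (1 + (cutRecip θ : ℂ) * z) =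
      π * circleAverage (fun w => Complex.exp w / w / (1 + Complex.exp w / w * z)) 0 1 := by
  have h1 := hasSum_intervalIntegral_geometric (exp_pos 1).le hz pi_pos.le
    (Complex.continuous_ofReal.comp_continuousOn continuousOn_cutRecip) (fun θ hθ => by
      rw [Function.comp_apply, Complex.norm_real, norm_of_nonneg (cutRecip_nonneg hθ)]
      exact (cutRecip_mem_Icc hθ).2)
  have hcont : Continuous fun θ => Complex.exp (circleMap 0 1 θ) / circleMap 0 1 θ := by
    have h : Continuous (circleMap 0 1) := continuous_circleMap 0 1
    exact (Complex.continuous_exp.comp h).div h fun θ => circleMap_ne_center one_ne_zero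
  have h2 := hasSum_intervalIntegral_geometric (exp_pos 1).le hz two_pi_pos.le
    hcont.continuousOn (fun θ _ => norm_exp_div_le (norm_circleMap_zero_one θ))
  have hpi := Complex.ofReal_ne_zero.2 pi_ne_zero
  rw [circleAverage_def, Complex.real_smul, ← mul_assoc]
  refine h1.unique ?_
  refine (h2.mul_left (π * ((2 * π)⁻¹ : ℝ) : ℂ)).congr_fun fun n => ?_
  simp only [Function.comp_apply]
  rw [integral_cutRecip_pow, circleAverage_def, Complex.real_smul]
  ring

theorem norm_exp_sub_exp_le {a b : ℂ} (ha : ‖a‖ ≤ 1) (hb : ‖b‖ ≤ 1) :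
    ‖Complex.exp a - Complex.exp b‖ ≤ exp 1 * ‖a - b‖ := by
  refine (convex_closedBall (0 : ℂ) 1).norm_image_sub_le_of_norm_hasDerivWithin_le
    (fun w _ => (Complex.hasDerivAt_exp w).hasDerivWithinAt) (fun w hw => ?_)
    (mem_closedBall_zero_iff.2 hb) (mem_closedBall_zero_iff.2 ha)
  rw [Complex.norm_exp, exp_le_exp]
  exact (Complex.re_le_norm w).trans (mem_closedBall_zero_iff.1 hw)

/-- If `z = ζ * exp ζ` is small, then `-ζ` is the only zero of `w + z * exp w` in the unit disc, and
the value of the average is given by Cauchy's formula for `(w + ζ) / (w + z * exp w)` at `-ζ`. -/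
theorem circleAverage_inv_one_add {ζ : ℂ} (h1 : ‖ζ‖ < 1)
    (h2 : ‖ζ * Complex.exp ζ‖ * exp 1 < 1) :
    circleAverage (fun w => (1 + Complex.exp w / w * (ζ * Complex.exp ζ))⁻¹) 0 1 = (1 + ζ)⁻¹ := by
  set z := ζ * Complex.exp ζ with hz
  set g : ℂ → ℂ := fun w => w + z * Complex.exp w with hg
  have hzζ : z * Complex.exp (-ζ) = ζ := by
    rw [hz, mul_assoc, ← Complex.exp_add, add_neg_cancel, Complex.exp_zero, mul_one]
  have hg0 : g (-ζ) = 0 := by rw [hg]; simp only; rw [hzζ]; ring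
  have hgd : ∀ w, HasDerivAt g (1 + z * Complex.exp w) w := fun w =>
    (hasDerivAt_id w).add ((Complex.hasDerivAt_exp w).const_mul z)
  have hgne : ∀ w, ‖w‖ ≤ 1 → w ≠ -ζ → g w ≠ 0 := by
    intro w hw hne h0
    have e : w - -ζ = -(z * (Complex.exp w - Complex.exp (-ζ))) := by
      rw [mul_sub, hzζ]
      linear_combination (h0 : w + z * Complex.exp w = 0)
    have h3 : 0 < ‖w - -ζ‖ := norm_pos_iff.2 (sub_ne_zero.2 hne)
    have h4 := norm_exp_sub_exp_le hw (b := -ζ) (by rw [norm_neg]; exact h1.le)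
    have h5 : ‖w - -ζ‖ = ‖z‖ * ‖Complex.exp w - Complex.exp (-ζ)‖ := by
      rw [← norm_mul, ← norm_neg (z * _), ← e]
    nlinarith [norm_nonneg z, mul_le_mul_of_nonneg_left h4 (norm_nonneg z)]
  set h := dslope g (-ζ) with hh
  have hhd : Differentiable ℂ h := by
    rw [← differentiableOn_univ, hh, Complex.differentiableOn_dslope univ_mem]
    exact fun w _ => (hgd w).differentiableAt.differentiableWithinAt
  have hhζ : h (-ζ) = 1 + ζ := by rw [hh, dslope_same, (hgd _).deriv, hzζ]
  have hhw : ∀ w, w ≠ -ζ → h w = g w / (w - -ζ) := fun w hw => by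
    rw [hh, dslope_of_ne _ hw, slope_def_field, hg0, sub_zero]
  have hhne : ∀ w ∈ Metric.closedBall (0 : ℂ) 1, h w ≠ 0 := by
    intro w hw
    rcases eq_or_ne w (-ζ) with rfl | hne
    · rw [hhζ]
      intro h0
      have : ζ = -1 := by linear_combination h0
      simp [this] at h1
    · rw [hhw w hne]
      exact div_ne_zero (hgne w (mem_closedBall_zero_iff.1 hw) hne) (sub_ne_zero.2 hne)
  have hdc : DiffContOnCl ℂ (fun w => (h w)⁻¹) (Metric.ball 0 |1|) := by
    rw [abs_one]
    refine DifferentiableOn.diffContOnCl ?_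
    rw [closure_ball _ one_ne_zero]
    exact hhd.differentiableOn.inv hhne
  have := hdc.circleAverage_smul_div (w := -ζ) (by simpa using h1)
  rw [hhζ] at this
  rw [← this]
  refine circleAverage_congr_sphere fun w hw => ?_
  have hw1 : ‖w‖ = 1 := by simpa using hw
  have hne : w ≠ -ζ := fun e => by rw [e, norm_neg] at hw1; exact h1.ne hw1
  have hw0 : w ≠ 0 := fun e => by simp [e] at hw1
  have hgw := hgne w hw1.le hne
  have hsub := sub_ne_zero.2 hne
  simp only [hhw w hne, sub_zero, smul_eq_mul]
  have e : 1 + Complex.exp w / w * z = g w / w := by rw [hg]; field_simp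
  rw [e]
  field_simp

theorem circleAverage_exp_div : circleAverage (fun w => Complex.exp w / w) 0 1 = 1 := by
  have := Complex.two_pi_I_inv_smul_circleIntegral_sub_sq_inv_smul_of_differentiable isOpen_univ
    (subset_univ (Metric.closedBall (0 : ℂ) 1)) Complex.differentiable_exp.differentiableOn
    (Metric.mem_ball_self one_pos)
  rw [Complex.deriv_exp, Complex.exp_zero] at this
  rw [circleAverage_eq_circleIntegral one_ne_zero, ← this]
  congr 2
  funext w
  simp only [smul_eq_mul, sub_zero]
  ring

/-- The derivative of `cutLogMean` at `ζ * exp ζ` is that of the inverse function of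
`ζ ↦ ζ * exp ζ`. -/
theorem hasDerivAt_cutLogMean_mul_exp {ζ : ℂ} (h1 : ‖ζ‖ < 1) (h2 : ‖ζ * Complex.exp ζ‖ * exp 1 < 1) :
    HasDerivAt cutLogMean ((1 + ζ) * Complex.exp ζ)⁻¹ (ζ * Complex.exp ζ) := by
  refine (hasDerivAt_cutLogMean (mem_lambertDomain_of_norm h2)).congr_deriv ?_
  rw [integral_cutRecip_div h2]
  have hpi := Complex.ofReal_ne_zero.2 pi_ne_zero
  have e0 : ∀ x : ℂ, ((1 / π : ℝ) : ℂ) * (π * x) = x := fun x => by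
    push_cast; field_simp
  rw [e0]
  rcases eq_or_ne ζ 0 with rfl | hζ
  · simpa using circleAverage_exp_div
  -- for `z ≠ 0` use `z q / (1 + z q) = 1 - 1 / (1 + z q)`, where the pole of `q` at `0` is gone
  set z := ζ * Complex.exp ζ with hz
  have hz0 : z ≠ 0 := mul_ne_zero hζ (Complex.exp_ne_zero _)
  have hne : ∀ w : ℂ, ‖w‖ = 1 → 1 + Complex.exp w / w * z ≠ 0 := fun w hw h0 => by
    have h3 : ‖Complex.exp w / w * z‖ < 1 := by
      rw [norm_mul, mul_comm]
      exact (mul_le_mul_of_nonneg_left (norm_exp_div_le hw) (norm_nonneg z)).trans_lt h2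
    rw [show Complex.exp w / w * z = -1 by linear_combination h0] at h3
    simp at h3
  have hci : CircleIntegrable (fun w => (1 + Complex.exp w / w * z)⁻¹) 0 1 := by
    refine ContinuousOn.circleIntegrable zero_le_one ?_
    have hs : ∀ w ∈ Metric.sphere (0 : ℂ) 1, ‖w‖ = 1 := fun w hw => by simpa using hw
    refine ContinuousOn.inv₀ ?_ fun w hw => hne w (hs w hw)
    refine continuousOn_const.add (ContinuousOn.mul ?_ continuousOn_const)
    exact Complex.continuous_exp.continuousOn.div continuousOn_id fun w hw e => by
      have := hs w hw
      simp [show w = 0 from e] at this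
  have e1 : circleAverage (fun w => Complex.exp w / w / (1 + Complex.exp w / w * z)) 0 1 =
      z⁻¹ * (1 - (1 + ζ)⁻¹) := by
    have hc : (1 : ℂ) = circleAverage (fun _ => (1 : ℂ)) 0 1 := (circleAverage_const _ _ _).symm
    rw [← circleAverage_inv_one_add h1 h2]
    nth_rewrite 2 [hc]
    rw [← circleAverage_sub (circleIntegrable_const _ _ _) hci, ← smul_eq_mul z⁻¹,
      ← circleAverage_smul]
    refine circleAverage_congr_sphere fun w hw => ?_
    have hw1 : ‖w‖ = 1 := by simpa using hw
    have := hne w hw1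
    simp only [Pi.smul_apply, Pi.sub_apply, smul_eq_mul]
    generalize Complex.exp w / w = q at this ⊢
    field_simp
    ring
  have hζ1 : 1 + ζ ≠ 0 := fun h0 => by
    rw [show ζ = -1 by linear_combination h0] at h1
    simp at h1
  rw [e1, hz]
  have := Complex.exp_ne_zero ζ
  field_simp
  ring

theorem eventually_cutLogMean_mul_exp : ∀ᶠ ζ in 𝓝 (0 : ℂ), cutLogMean (ζ * Complex.exp ζ) = ζ := by
  have hev : ∀ᶠ ζ in 𝓝 (0 : ℂ), ‖ζ‖ < 1 ∧ ‖ζ * Complex.exp ζ‖ * exp 1 < 1 := by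
    refine ((continuous_norm.tendsto (0 : ℂ)).eventually_lt_const (by simp)).and ?_
    have : Continuous fun ζ : ℂ => ‖ζ * Complex.exp ζ‖ * exp 1 := by fun_prop
    exact (this.tendsto 0).eventually_lt_const (by simp)
  obtain ⟨r, hr, hball⟩ := Metric.eventually_nhds_iff_ball.1 hev
  have hder : ∀ ζ ∈ Metric.ball (0 : ℂ) r,
      HasDerivAt (fun ζ => cutLogMean (ζ * Complex.exp ζ) - ζ) 0 ζ := by
    intro ζ hζ
    obtain ⟨h1, h2⟩ := hball ζ hζ
    have hζ1 : 1 + ζ ≠ 0 := fun h0 => by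
      rw [show ζ = -1 by linear_combination h0] at h1
      simp at h1
    have h3 : HasDerivAt (fun ζ : ℂ => ζ * Complex.exp ζ) ((1 + ζ) * Complex.exp ζ) ζ := by
      refine ((hasDerivAt_id ζ).mul (Complex.hasDerivAt_exp ζ)).congr_deriv ?_
      simp only [id]; ring
    have h4 := ((hasDerivAt_cutLogMean_mul_exp h1 h2).comp ζ h3).sub (hasDerivAt_id ζ)
    refine h4.congr_deriv ?_
    rw [inv_mul_cancel₀ (mul_ne_zero hζ1 (Complex.exp_ne_zero _)), sub_self]
  refine Metric.eventually_nhds_iff_ball.2 ⟨r, hr, fun ζ hζ => ?_⟩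
  have := Metric.isOpen_ball.is_const_of_deriv_eq_zero (convex_ball (0 : ℂ) r).isPreconnected
    (fun ζ hζ => (hder ζ hζ).differentiableAt.differentiableWithinAt)
    (fun ζ hζ => (hder ζ hζ).deriv) hζ (Metric.mem_ball_self hr)
  rw [zero_mul, cutLogMean_zero, sub_self] at this
  exact sub_eq_zero.1 this

theorem differentiableOn_cutLogMean : DifferentiableOn ℂ cutLogMean lambertDomain := fun _ hz =>
  (hasDerivAt_cutLogMean hz).differentiableAt.differentiableWithinAt

theorem cutLogMean_mul_exp {z : ℂ} (hz : z ∈ lambertDomain) :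
    cutLogMean z * Complex.exp (cutLogMean z) = z := by
  have hd : DifferentiableOn ℂ (fun z => cutLogMean z * Complex.exp (cutLogMean z)) lambertDomain :=
    differentiableOn_cutLogMean.mul differentiableOn_cutLogMean.cexp
  refine (hd.analyticOnNhd isOpen_lambertDomain).eqOn_of_preconnected_of_frequently_eq
    (differentiableOn_id.analyticOnNhd isOpen_lambertDomain) isPreconnected_lambertDomain
    (z₀ := 0) (mem_lambertDomain_of_norm (by simp)) ?_ hz
  have htend : Tendsto (fun ζ : ℂ => ζ * Complex.exp ζ) (𝓝[≠] 0) (𝓝[≠] 0) := by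
    refine tendsto_nhdsWithin_iff.2 ⟨?_, ?_⟩
    · have : Continuous fun ζ : ℂ => ζ * Complex.exp ζ := by fun_prop
      simpa using (this.tendsto 0).mono_left nhdsWithin_le_nhds
    · exact eventually_mem_nhdsWithin.mono fun ζ hζ => mul_ne_zero hζ (Complex.exp_ne_zero _)
  refine htend.frequently (Eventually.frequently ?_)
  filter_upwards [eventually_cutLogMean_mul_exp.filter_mono nhdsWithin_le_nhds] with ζ hζ
  simp only [hζ, id]

/-- The imaginary part is a mean of arguments. -/
theorem abs_im_cutLogMean_le {z : ℂ} (hz : z ∈ lambertDomain) : |(cutLogMean z).im| ≤ π := by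
  have hint : IntervalIntegrable (fun θ => Complex.log (1 + (cutRecip θ : ℂ) * z)) volume 0 π := by
    refine ContinuousOn.intervalIntegrable ?_
    rw [uIcc_of_le pi_pos.le]
    exact continuousOn_log_one_add_cutRecip hz
  have h1 : (cutLogMean z).im =
      1 / π * ∫ θ in (0 : ℝ)..π, (Complex.log (1 + (cutRecip θ : ℂ) * z)).im := by
    rw [cutLogMean, Complex.im_ofReal_mul]
    congr 1
    exact (Complex.imCLM.intervalIntegral_comp_comm hint).symm
  have h2 : ‖∫ θ in (0 : ℝ)..π, (Complex.log (1 + (cutRecip θ : ℂ) * z)).im‖ ≤ π * |π - 0| :=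
    intervalIntegral.norm_integral_le_of_norm_le_const fun θ _ => by
      rw [Complex.log_im, norm_eq_abs]; exact Complex.abs_arg_le_pi _
  rw [h1, abs_mul, abs_of_pos (one_div_pos.2 pi_pos), one_div, inv_mul_le_iff₀ pi_pos]
  rwa [sub_zero, abs_of_pos pi_pos, norm_eq_abs] at h2

/-- The function `rangeSide` has no zero on the connected set of the values of `cutLogMean`, as a
zero would be mapped to the cut. -/
theorem cutLogMean_mem_lambertRange {z : ℂ} (hz : z ∈ lambertDomain) :
    cutLogMean z ∈ lambertRange := by
  have h0 : (0 : ℂ) ∈ lambertDomain := mem_lambertDomain_of_norm (by simp)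
  have hlt : ∀ x ∈ lambertDomain, 0 ≤ rangeSide (cutLogMean x) → |(cutLogMean x).im| < π := by
    intro x hx h
    refine (abs_im_cutLogMean_le hx).lt_of_ne fun e => ?_
    have : rangeSide (cutLogMean x) = -1 := by
      rcases eq_or_eq_neg_of_abs_eq e with e | e <;> simp [rangeSide, e, sinc_pi]
    linarith
  have hne : ∀ x ∈ lambertDomain, rangeSide (cutLogMean x) ≠ 0 := by
    intro x hx h
    have hp := hlt x hx h.ge
    have h1 := mul_exp_of_rangeSide_eq_zero hp h
    rw [cutLogMean_mul_exp hx] at h1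
    refine hx ?_
    rw [h1]
    refine ⟨Complex.ofReal_im _, ?_⟩
    rw [Complex.ofReal_re, neg_div, neg_div, neg_le_neg_iff]
    exact one_div_le_one_div_of_le (cutRecip_pos hp) (cutRecip_le_exp_one hp)
  have hpos : 0 < rangeSide (cutLogMean z) := by
    by_contra! hneg
    have hc : ContinuousOn (fun x => rangeSide (cutLogMean x)) lambertDomain :=
      continuous_rangeSide.comp_continuousOn differentiableOn_cutLogMean.continuousOn
    obtain ⟨x, hx, hx0⟩ := isPreconnected_lambertDomain.intermediate_value hz h0 hc
      (show (0 : ℝ) ∈ Icc _ _ from ⟨hneg, by simp [cutLogMean_zero, rangeSide]⟩)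
    exact hne x hx hx0
  exact mem_lambertRange_iff.2 ⟨hlt z hz hpos.le, hpos.le, fun _ => hpos⟩

theorem lambertW_eq_cutLogMean {z : ℂ} (hz : z ∈ lambertDomain) : lambertW z = cutLogMean z := by
  have := lambertW_mul_exp (cutLogMean_mem_lambertRange hz)
  rwa [cutLogMean_mul_exp hz] at this

/-! ### The Stieltjes integral -/

theorem intervalIntegrable_cutIm (a b : ℝ) : IntervalIntegrable cutIm volume a b := by
  refine (intervalIntegrable_const (c := π)).mono_fun measurable_cutIm.aestronglyMeasurable
    (Eventually.of_forall fun u => ?_)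
  simp only [norm_of_nonneg (cutIm_mem_Ico u).1, norm_of_nonneg pi_pos.le]
  exact (cutIm_mem_Ico u).2.le

/-- Fubini's theorem for `g u` on the region `u < cutRecip θ`, that is, `θ < cutIm u`. -/
theorem integral_cutIm_mul {g : ℝ → ℂ} (hg : ContinuousOn g (Icc 0 (exp 1))) :
    ∫ u in (0 : ℝ)..exp 1, (cutIm u : ℂ) * g u =
      ∫ θ in (0 : ℝ)..π, ∫ u in (0 : ℝ)..cutRecip θ, g u := by
  set S : Set (ℝ × ℝ) := {p | p.1 < cutRecip p.2} with hS
  have hSm : MeasurableSet S :=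
    measurableSet_lt measurable_fst (measurable_cutRecip.comp measurable_snd)
  have hgi : Integrable g (volume.restrict (Ioo 0 (exp 1))) :=
    (hg.integrableOn_compact isCompact_Icc).mono_set Ioo_subset_Icc_self
  have hint : Integrable (Function.uncurry fun u θ => S.indicator (fun p => g p.1) (u, θ))
      ((volume.restrict (Ioo 0 (exp 1))).prod (volume.restrict (Ioo 0 π))) :=
    (hgi.comp_fst _).indicator hSm
  rw [intervalIntegral.integral_of_le (exp_pos 1).le, intervalIntegral.integral_of_le pi_pos.le,
    integral_Ioc_eq_integral_Ioo, integral_Ioc_eq_integral_Ioo]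
  convert integral_integral_swap hint using 1
  · refine setIntegral_congr_fun measurableSet_Ioo fun u hu => ?_
    have hc := cutIm_mem_Ico u
    have h1 : ∀ θ ∈ Ioo 0 π, S.indicator (fun p => g p.1) (u, θ) =
        (Ioo 0 (cutIm u)).indicator (fun _ => g u) θ := by
      intro θ hθ
      have : (u, θ) ∈ S ↔ θ ∈ Ioo 0 (cutIm u) := by
        rw [mem_Ioo, lt_cutIm_iff hu.1 ⟨hθ.1.le, hθ.2⟩]
        exact ⟨fun h => ⟨hθ.1, h⟩, fun h => h.2⟩
      by_cases h : (u, θ) ∈ S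
      · rw [indicator_of_mem h, indicator_of_mem (this.1 h)]
      · rw [indicator_of_notMem h, indicator_of_notMem (mt this.2 h)]
    rw [setIntegral_congr_fun measurableSet_Ioo h1, setIntegral_indicator measurableSet_Ioo,
      inter_eq_self_of_subset_right (Ioo_subset_Ioo_right hc.2.le), setIntegral_const,
      volume_real_Ioo_of_le hc.1, sub_zero, Complex.real_smul]
  · refine setIntegral_congr_fun measurableSet_Ioo fun θ hθ => ?_
    have hc := cutRecip_mem_Icc (Ioo_subset_Icc_self hθ)
    have h1 : ∀ u ∈ Ioo 0 (exp 1), S.indicator (fun p => g p.1) (u, θ) =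
        (Ioo 0 (cutRecip θ)).indicator g u := by
      intro u hu
      have : (u, θ) ∈ S ↔ u ∈ Ioo 0 (cutRecip θ) := ⟨fun h => ⟨hu.1, h⟩, fun h => h.2⟩
      by_cases h : (u, θ) ∈ S
      · rw [indicator_of_mem h, indicator_of_mem (this.1 h)]
      · rw [indicator_of_notMem h, indicator_of_notMem (mt this.2 h)]
    rw [setIntegral_congr_fun measurableSet_Ioo h1, setIntegral_indicator measurableSet_Ioo,
      inter_eq_self_of_subset_right (Ioo_subset_Ioo_right hc.2),
      intervalIntegral.integral_of_le hc.1, integral_Ioc_eq_integral_Ioo]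

theorem continuousOn_one_div_one_add {z : ℂ} (hz : z ∈ lambertDomain) :
    ContinuousOn (fun u : ℝ => 1 / (1 + (u : ℂ) * z)) (Icc 0 (exp 1)) :=
  ContinuousOn.div (by fun_prop) (by fun_prop) fun _ hu =>
    Complex.slitPlane_ne_zero (one_add_mul_mem_slitPlane hz hu)

theorem cutLogMean_eq {z : ℂ} (hz : z ∈ lambertDomain) :
    cutLogMean z =
      z * ∫ u in (0 : ℝ)..exp 1, ((cutIm u / π : ℝ) : ℂ) * (1 / (1 + (u : ℂ) * z)) := by
  have h1 := integral_cutIm_mul ((continuousOn_one_div_one_add hz).const_mul z)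
  have h2 : ∀ θ ∈ uIcc 0 π, ∫ u in (0 : ℝ)..cutRecip θ, z * (1 / (1 + (u : ℂ) * z)) =
      Complex.log (1 + (cutRecip θ : ℂ) * z) := by
    intro θ hθ
    rw [uIcc_of_le pi_pos.le] at hθ
    have hc := cutRecip_mem_Icc hθ
    have hsub : ∀ u ∈ uIcc 0 (cutRecip θ), u ∈ Icc 0 (exp 1) := fun u hu => by
      rw [uIcc_of_le hc.1] at hu
      exact ⟨hu.1, hu.2.trans hc.2⟩
    have hder : ∀ u ∈ uIcc 0 (cutRecip θ), HasDerivAt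
        (fun u : ℝ => Complex.log (1 + (u : ℂ) * z)) (z * (1 / (1 + (u : ℂ) * z))) u := by
      intro u hu
      have h : HasDerivAt (fun u : ℝ => 1 + (u : ℂ) * z) z u := by
        simpa using ((Complex.ofRealCLM.hasDerivAt (x := u)).mul_const z).const_add 1
      rw [mul_one_div]
      exact h.clog_real (one_add_mul_mem_slitPlane hz (hsub u hu))
    rw [intervalIntegral.integral_eq_sub_of_hasDerivAt hder
      (((continuousOn_one_div_one_add hz).const_mul z).mono hsub).intervalIntegrable]
    simp
  rw [cutLogMean, ← intervalIntegral.integral_congr h2, ← h1,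
    ← intervalIntegral.integral_const_mul, ← intervalIntegral.integral_const_mul]
  refine intervalIntegral.integral_congr fun u _ => ?_
  push_cast
  ring

theorem integral_cutIm_div_pi : ∫ u in (0 : ℝ)..exp 1, ((cutIm u / π : ℝ) : ℂ) = 1 := by
  have h1 := integral_cutIm_mul (g := fun _ => 1) continuousOn_const
  simp only [mul_one, intervalIntegral.integral_const, sub_zero, Complex.real_smul] at h1
  have h2 := integral_cutRecip_pow 1
  simp only [pow_one] at h2
  rw [h2, circleAverage_exp_div, mul_one] at h1
  push_cast
  rw [intervalIntegral.integral_div, h1, div_self (Complex.ofReal_ne_zero.2 pi_ne_zero)]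

/-- The representation of `W(z) / z` with the density of `Φ` written out. -/
theorem lambertQuot_eq_integral {z : ℂ} (hz : z ∈ lambertDomain) :
    lambertQuot z =
      ∫ u in (0 : ℝ)..exp 1, ((cutIm u / π : ℝ) : ℂ) * (1 / (1 + (u : ℂ) * z)) := by
  rw [lambertQuot]
  split_ifs with h
  · subst h
    simpa using integral_cutIm_div_pi.symm
  · rw [lambertW_eq_cutLogMean hz, cutLogMean_eq hz, mul_div_cancel_left₀ _ h]

theorem slitPlane_subset_lambertDomain : Complex.slitPlane ⊆ lambertDomain := fun z hz h => by
  have hneg : -1 / exp 1 < 0 := div_neg_of_neg_of_pos (by norm_num) (exp_pos _)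
  rcases hz with h1 | h1
  · linarith [h.2]
  · exact h1 h.1

theorem lambertW_div_eq_lambertQuot {z : ℂ} (hz : z ≠ 0) : lambertW z / z = lambertQuot z := by
  rw [lambertQuot, if_neg hz]

/-- The density `Im W(-1/u) / π` of the measure `dΦ`. -/
def cutDensity (u : ℝ) : NNReal := (cutIm u / π).toNNReal

theorem measurable_cutDensity : Measurable cutDensity := (measurable_cutIm.div_const π).real_toNNReal

theorem coe_cutDensity (u : ℝ) : (cutDensity u : ℝ) = cutIm u / π :=
  coe_toNNReal _ (div_nonneg (cutIm_mem_Ico u).1 pi_pos.le)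

theorem lambertPhi_sub (a b : ℝ) :
    lambertPhi b - lambertPhi a = ∫ u in a..b, cutIm u / π := by
  rw [intervalIntegral.integral_div, ← intervalIntegral.integral_interval_sub_left
    (intervalIntegrable_cutIm 0 b) (intervalIntegrable_cutIm 0 a)]
  simp only [lambertPhi, cutIm]
  ring

theorem monotone_lambertPhi : Monotone lambertPhi := fun a b h => by
  rw [← sub_nonneg, lambertPhi_sub]
  exact intervalIntegral.integral_nonneg h fun u _ => div_nonneg (cutIm_mem_Ico u).1 pi_pos.le

theorem continuous_lambertPhi : Continuous lambertPhi :=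
  (intervalIntegral.continuous_primitive intervalIntegrable_cutIm 0).const_mul (1 / π)

theorem lambertPhi_of_nonpos {u : ℝ} (h : u ≤ 0) : lambertPhi u = lambertPhi 0 := by
  have h1 := lambertPhi_sub u 0
  rw [intervalIntegral.integral_congr (g := fun _ => 0) fun x hx => by
    rw [uIcc_of_le h] at hx
    simp only [cutIm_of_nonpos hx.2, zero_div]] at h1
  simp only [intervalIntegral.integral_zero] at h1
  linarith

theorem lambertPhi_of_exp_one_le {u : ℝ} (h : exp 1 ≤ u) : lambertPhi u = lambertPhi (exp 1) := by
  have h1 := lambertPhi_sub (exp 1) u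
  rw [intervalIntegral.integral_congr (g := fun _ => 0) fun x hx => by
    rw [uIcc_of_le h] at hx
    simp only [cutIm_of_exp_one_le hx.1, zero_div]] at h1
  simp only [intervalIntegral.integral_zero] at h1
  linarith

theorem stieltjesMeasure_lambertPhi (hΦ : MonotoneOn lambertPhi (Ici 0)) :
    stieltjesMeasure lambertPhi hΦ = volume.withDensity fun u => (cutDensity u : ENNReal) := by
  have hval : ∀ x, (monotone_comp_max hΦ).stieltjesFunction x = lambertPhi x := by
    have hfun : (fun u : ℝ => lambertPhi (max u 0)) = lambertPhi := by
      funext u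
      rcases le_total u 0 with h | h
      · rw [max_eq_right h, lambertPhi_of_nonpos h]
      · rw [max_eq_left h]
    intro x
    rw [Monotone.stieltjesFunction_eq, hfun]
    exact (continuous_lambertPhi.continuousAt.continuousWithinAt).rightLim_eq
  refine Measure.ext_of_Ioc' _ _ (fun a b _ => ?_) fun a b hab => ?_
  · rw [stieltjesMeasure, StieltjesFunction.measure_Ioc]
    exact ENNReal.ofReal_ne_top
  · rw [stieltjesMeasure, StieltjesFunction.measure_Ioc, hval, hval, lambertPhi_sub,
      withDensity_apply _ measurableSet_Ioc, intervalIntegral.integral_of_le hab.le,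
      ofReal_integral_eq_lintegral_ofReal
        (((intervalIntegrable_cutIm a b).div_const π).1)
        (Eventually.of_forall fun u => div_nonneg (cutIm_mem_Ico u).1 pi_pos.le)]
    rfl

theorem cutDensity_smul (u : ℝ) (c : ℂ) :
    cutDensity u • c = ((cutIm u / π : ℝ) : ℂ) * c := by
  rw [NNReal.smul_def, coe_cutDensity, Complex.real_smul]

theorem cutDensity_smul_eq_zero {u : ℝ} (h : u ∉ Icc 0 (exp 1)) (c : ℂ) :
    cutDensity u • c = 0 := by
  have : cutIm u = 0 := by
    rcases le_or_gt u 0 with h1 | h1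
    · exact cutIm_of_nonpos h1
    · exact cutIm_of_exp_one_le (le_of_not_ge fun h2 => h ⟨h1.le, h2⟩)
  rw [cutDensity_smul, this]
  simp

theorem integrableOn_cutDensity_smul {z : ℂ} (hz : z ∈ lambertDomain) :
    IntegrableOn (fun u : ℝ => cutDensity u • (1 / (1 + (u : ℂ) * z))) (Icc 0 (exp 1)) := by
  simp only [cutDensity_smul]
  rw [integrableOn_Icc_iff_integrableOn_Ioc, ← intervalIntegrable_iff_integrableOn_Ioc_of_le
    (exp_pos 1).le]
  have h1 : IntervalIntegrable (fun u => ((cutIm u / π : ℝ) : ℂ)) volume 0 (exp 1) := by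
    have h := (intervalIntegrable_cutIm 0 (exp 1)).div_const π
    exact ⟨h.1.ofReal, h.2.ofReal⟩
  refine h1.mul_continuousOn ?_
  rw [uIcc_of_le (exp_pos 1).le]
  exact continuousOn_one_div_one_add hz

theorem integrableOn_stieltjesMeasure {z : ℂ} (hz : z ∈ lambertDomain)
    (hΦ : MonotoneOn lambertPhi (Ici 0)) {s : Set ℝ} (hs : MeasurableSet s) :
    IntegrableOn (fun u : ℝ => 1 / (1 + (u : ℂ) * z)) s (stieltjesMeasure lambertPhi hΦ) := by
  rw [stieltjesMeasure_lambertPhi, IntegrableOn, restrict_withDensity hs,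
    integrable_withDensity_iff_integrable_smul measurable_cutDensity]
  exact (integrableOn_cutDensity_smul hz).of_forall_sdiff_eq_zero hs
    fun u hu => cutDensity_smul_eq_zero hu.2 _

theorem lambertQuot_eq_stieltjes {z : ℂ} (hz : z ∈ lambertDomain)
    (hΦ : MonotoneOn lambertPhi (Ici 0)) {s : Set ℝ} (hs : MeasurableSet s)
    (hsub : Icc 0 (exp 1) ⊆ s) :
    lambertQuot z = ∫ u in s, 1 / (1 + (u : ℂ) * z) ∂(stieltjesMeasure lambertPhi hΦ) := by
  rw [stieltjesMeasure_lambertPhi, setIntegral_withDensity_eq_setIntegral_smul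
    measurable_cutDensity _ hs, setIntegral_eq_of_subset_of_forall_sdiff_eq_zero hs hsub
    fun u hu => cutDensity_smul_eq_zero hu.2 _, lambertQuot_eq_integral hz,
    intervalIntegral.integral_of_le (exp_pos 1).le, integral_Icc_eq_integral_Ioc]
  simp only [cutDensity_smul]

theorem isStieltjesIntegral_lambert :
    IsStieltjesIntegral (fun z : ℂ => lambertW z / z) lambertPhi where
  mono := monotone_lambertPhi.monotoneOn _
  bounded := by
    refine ⟨lambertPhi (exp 1), fun u hu => ?_⟩
    have h0 : lambertPhi 0 = 0 := by simp [lambertPhi]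
    rw [abs_of_nonneg (h0 ▸ monotone_lambertPhi hu)]
    rcases le_total u (exp 1) with h | h
    · exact monotone_lambertPhi h
    · exact (lambertPhi_of_exp_one_le h).le
  integrable z hz := integrableOn_stieltjesMeasure (slitPlane_subset_lambertDomain hz) _
    measurableSet_Ici
  eq_integral z hz := by
    rw [lambertW_div_eq_lambertQuot (Complex.slitPlane_ne_zero hz)]
    exact lambertQuot_eq_stieltjes (slitPlane_subset_lambertDomain hz) _ measurableSet_Ici
      Icc_subset_Ici_self

/-- The substitution `t = 1 / u` turns `dΦ(u) / (1 + u x)` into `dμ(t) / (x + t)`, where `μ` is the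
image of the measure `dΦ(u) / u`. -/
theorem isStieltjesFunction_integral :
    IsStieltjesFunction fun x => ∫ u in (0 : ℝ)..exp 1, cutIm u / π * (1 / (1 + u * x)) := by
  set d : ℝ → NNReal := fun u => (cutIm u / π / u).toNNReal with hd
  have hdm : Measurable d := ((measurable_cutIm.div_const π).div measurable_id).real_toNNReal
  set ν : Measure ℝ := (volume.restrict (Ioc 0 (exp 1))).withDensity fun u => (d u : ENNReal)
    with hν
  have hφ : Measurable fun u : ℝ => (1 / u).toNNReal :=
    (measurable_const.div measurable_id).real_toNNReal
  have hpt : ∀ x : ℝ, 0 < x → ∀ u ∈ Ioc 0 (exp 1),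
      d u • (1 / (x + ((1 / u).toNNReal : ℝ))) = cutIm u / π * (1 / (1 + u * x)) := by
    intro x hx u hu
    have hu0 := hu.1
    rw [NNReal.smul_def, hd, coe_toNNReal _ (by have := (cutIm_mem_Ico u).1; positivity),
      coe_toNNReal _ (by positivity), smul_eq_mul]
    field_simp
    ring
  have hint : ∀ x : ℝ, 0 < x →
      IntegrableOn (fun u => cutIm u / π * (1 / (1 + u * x))) (Ioc 0 (exp 1)) := by
    intro x hx
    rw [← intervalIntegrable_iff_integrableOn_Ioc_of_le (exp_pos 1).le]
    refine ((intervalIntegrable_cutIm _ _).div_const π).mul_continuousOn ?_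
    refine ContinuousOn.div (by fun_prop) (by fun_prop) fun u hu => ?_
    rw [uIcc_of_le (exp_pos 1).le] at hu
    have := mul_nonneg hu.1 hx.le
    positivity
  have hmeas : ∀ x : ℝ, Measurable fun t : NNReal => 1 / (x + (t : ℝ)) := fun x =>
    measurable_const.div (measurable_const.add measurable_subtype_coe)
  refine ⟨0, le_rfl, ν.map fun u => (1 / u).toNNReal, ?_, fun x hx => ?_⟩
  · simp only [← one_div]
    rw [integrable_map_measure (hmeas 1).aestronglyMeasurable hφ.aemeasurable, hν,
      integrable_withDensity_iff_integrable_smul hdm]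
    exact ((integrableOn_congr_fun (hpt 1 one_pos) measurableSet_Ioc).2 (hint 1 one_pos))
  · rw [zero_add, integral_map hφ.aemeasurable (hmeas x).aestronglyMeasurable, hν,
      integral_withDensity_eq_integral_smul hdm, setIntegral_congr_fun measurableSet_Ioc (hpt x hx)]
    exact intervalIntegral.integral_of_le (exp_pos 1).le

theorem lambertW_div_ofReal {x : ℝ} (hx : 0 < x) :
    lambertW (x : ℂ) / (x : ℂ) =
      ((∫ u in (0 : ℝ)..exp 1, cutIm u / π * (1 / (1 + u * x)) : ℝ) : ℂ) := by
  have hz : (x : ℂ) ∈ lambertDomain := slitPlane_subset_lambertDomain (Or.inl (by simpa using hx))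
  rw [lambertW_div_eq_lambertQuot (Complex.ofReal_ne_zero.2 hx.ne'), lambertQuot_eq_integral hz,
    ← intervalIntegral.integral_ofReal]
  push_cast
  rfl

end LambertStieltjes

theorem mainTheorem2 :
    -- on the positive half-line `W(x)/x` is a (real) Stieltjes function
    (∃ f : ℝ → ℝ, IsStieltjesFunction f ∧
      ∀ x : ℝ, 0 < x → lambertW (x : ℂ) / (x : ℂ) = (f x : ℂ)) ∧
    -- the integral that defines `Φ` converges
    (∀ u : ℝ, 0 ≤ u → IntervalIntegrable
      (fun t : ℝ => (lambertW ((-1 / t : ℝ) : ℂ)).im) MeasureTheory.volume 0 u) ∧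
    -- `Φ` does not grow beyond `e`
    (∀ u : ℝ, Real.exp 1 ≤ u → lambertPhi u = lambertPhi (Real.exp 1)) ∧
    -- in `ℂ ∖ (-∞, 0]`: `W(z)/z = ∫₀^∞ dΦ(u)/(1 + u z)`, with `Φ` bounded and nondecreasing
    IsStieltjesIntegral (fun z : ℂ => lambertW z / z) lambertPhi ∧
    -- in `ℂ ∖ (-∞, -1/e]`: `W(z)/z = ∫₀^e dΦ(u)/(1 + u z)`
    ∃ hΦ : MonotoneOn lambertPhi (Set.Ici 0), ∀ z ∈ lambertDomain,
      MeasureTheory.IntegrableOn (fun u : ℝ => 1 / (1 + (u : ℂ) * z))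
        (Set.Icc 0 (Real.exp 1)) (stieltjesMeasure lambertPhi hΦ) ∧
      lambertQuot z = ∫ u in Set.Icc (0 : ℝ) (Real.exp 1), 1 / (1 + (u : ℂ) * z)
        ∂(stieltjesMeasure lambertPhi hΦ) := by
  refine ⟨⟨_, isStieltjesFunction_integral, fun x hx => lambertW_div_ofReal hx⟩,
    fun u _ => intervalIntegrable_cutIm 0 u, fun u hu => lambertPhi_of_exp_one_le hu,
    isStieltjesIntegral_lambert, monotone_lambertPhi.monotoneOn _, fun z hz => ⟨?_, ?_⟩⟩
  · exact integrableOn_stieltjesMeasure hz _ measurableSet_Icc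
  · exact lambertQuot_eq_stieltjes hz _ measurableSet_Icc subset_rfl
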